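/- Let $\mathbb{Q}(\alpha)$ be the field of rational functions in a parameter $\alpha$. For a partition $\lambda$ with conjugate $\lambda^t$ put $b(\lambda)=\sum_i\binom{\lambda_i}{2}$ and $\mathrm{hook}_\alpha(\lambda)=\prod_{\square\in\lambda}\bigl(\alpha\,a(\square)+\ell(\square)+1\bigr)$, where $a(\square)$ and $\ell(\square)$ are the arm and the leg of the box $\square$ in the Young diagram of $\lambda$. For $N\ge 0$ consider the Laplace--Beltrami operator in the variables $x_1,\dots,x_N$, $$D_\alpha=\sum_{i\le N}\sum_{j\ne i}\frac{x_i^2}{x_i-x_j}\frac{\partial}{\partial x_i}+\frac{\alpha}{2}\sum_{i\le N}x_i^2\frac{\partial^2}{\partial x_i^2}.$$ (1) For every $N$ and every partition $\lambda$ of length at most $N$ there is a unique symmetric polynomial $J_\lambda=J^{(\alpha)}_\lambda(x_1,\dots,x_N)$ over $\mathbb{Q}(\alpha)$, the Jack polynomial, such that $$D_\alpha J_\lambda=\bigl(\alpha\, b(\lambda)-b(\lambda^t)+(N-1)|\lambda|\bigr)J_\lambda\qquad\text{and}\qquad J_\lambda=\mathrm{hook}_\alpha(\lambda)\,m_\lambda+\sum_{\nu<\lambda}a^\lambda_\nu\,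 m_\nu\ \text{ for some } a^\lambda_\nu\in\mathbb{Q}(\alpha),$$ where $m_\nu$ are the monomial symmetric polynomials and $<$ is the strict dominance order on partitions of the same size. If $\lambda$ has more than $N$ parts, put $J_\lambda(x_1,\dots,x_N)=0$. (2) For every $N$ and $\lambda$ one has $J_\lambda(x_1,\dots,x_N,0)=J_\lambda(x_1,\dots,x_N)$, so that the Jack polynomials define symmetric functions. (3) Let $r\ge 1$ and let $\lambda^1,\dots,\lambda^r$ be partitions. For $B\subseteq[r]=\{1,\dots,r\}$ let $\lambda^B$ be the entry-wise sum of the $\lambda^i$, $i\in B$, and define the cumulant of Jack polynomials $$\kappa^J(\lambda^1,\dots,\lambda^r)=\sum_{\pi}\mu(\pi,\{[r]\})\prod_{B\in\pi}J_{\lambda^B},$$ where $\pi$ runs over the set partitions of $[r]$ and $\mu$ is the Möbius function of the lattice of set partitions of $[r]$ ordered by refinement. Then $$\kappa^J(\lambda^1,\dots,\lambda^r)=O(\alpha^{r-1})\quad\text{as }\alpha\to 0,$$ that is, in any number $N$ of variables, every coefficient $c\in\mathbb{Q}(\alpha)$ of this polynomial is such that $\alpha^{-(r-1)}c$ has no pole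 at $\alpha=0$. -/

import Mathlib

noncomputable section

namespace JackCumulant

/-! ### Partitions, represented by their Young diagrams

The `i`-th part of `lam` (counted from `0`) is `lam.rowLen i`, its length is `lam.colLen 0`, its size
is `lam.card`, and its conjugate is `lam.transpose`. -/

/-- The entry-wise sum `⨁_{i ∈ B} lam i`: its `k`-th part is the sum of the `k`-th parts of the
`lam i`, `i ∈ B` (see `rowLen_entrywiseSum`). The product of two ranges is only a bounding box. -/
def entrywiseSum {ι : Type*} (lam : ι → YoungDiagram) (B : Finset ι) : YoungDiagram where
  cells := ((Finset.range (∑ i ∈ B, (lam i).colLen 0)) ×ˢ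
    (Finset.range (∑ i ∈ B, (lam i).rowLen 0))).filter
      (fun c => c.2 < ∑ i ∈ B, (lam i).rowLen c.1)
  isLowerSet := by
    rintro ⟨a, b⟩ ⟨c, d⟩ ⟨h1, h2⟩ h
    simp only [Finset.coe_filter, Finset.mem_product, Finset.mem_range, Set.mem_ofPred_eq] at h ⊢
    simp only at h1 h2
    have := Finset.sum_le_sum (fun i (_ : i ∈ B) => (lam i).rowLen_anti c a h1)
    omega

theorem rowLen_entrywiseSum {ι : Type*} (lam : ι → YoungDiagram) (B : Finset ι) (k : ℕ) :
    (entrywiseSum lam B).rowLen k = ∑ i ∈ B, (lam i).rowLen k := by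
  have key : ∀ j, j < (entrywiseSum lam B).rowLen k ↔ j < ∑ i ∈ B, (lam i).rowLen k := by
    intro j
    rw [← YoungDiagram.mem_iff_lt_rowLen, ← YoungDiagram.mem_cells]
    simp only [entrywiseSum, Finset.mem_filter, Finset.mem_product, Finset.mem_range,
      and_iff_right_iff_imp]
    intro h
    constructor
    · obtain ⟨i, hi, hpos⟩ : ∃ i ∈ B, 0 < (lam i).rowLen k := by
        by_contra hcon
        push Not at hcon
        have : ∑ i ∈ B, (lam i).rowLen k = 0 :=
          Finset.sum_eq_zero (fun i hi => Nat.le_zero.mp (hcon i hi))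
        omega
      have h1 : k < (lam i).colLen 0 :=
        YoungDiagram.mem_iff_lt_colLen.mp (YoungDiagram.mem_iff_lt_rowLen.mpr hpos)
      exact lt_of_lt_of_le h1
        (Finset.single_le_sum (f := fun i => (lam i).colLen 0) (fun _ _ => Nat.zero_le _) hi)
    · exact lt_of_lt_of_le h
        (Finset.sum_le_sum (fun i _ => (lam i).rowLen_anti 0 k (Nat.zero_le k)))
  have h1 := key ((entrywiseSum lam B).rowLen k)
  have h2 := key (∑ i ∈ B, (lam i).rowLen k)
  omega

/-- `nu` is strictly smaller than `lam` in dominance order (on partitions of the same size). -/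
def DominanceLT (nu lam : YoungDiagram) : Prop :=
  nu.card = lam.card ∧ nu ≠ lam ∧
    ∀ j : ℕ, ∑ i ∈ Finset.range j, nu.rowLen i ≤ ∑ i ∈ Finset.range j, lam.rowLen i

/-- `b(lam) = ∑ i, binom (lam_i) 2`. -/
def bStat (lam : YoungDiagram) : ℕ :=
  ∑ i ∈ Finset.range (lam.colLen 0), (lam.rowLen i).choose 2

/-! ### Jack polynomials -/

/-- The field `ℚ(α)` of rational functions in the Jack parameter. -/
abbrev QAlpha : Type := RatFunc ℚ

/-- The Jack parameter `α`. -/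
abbrev alpha : QAlpha := RatFunc.X

/-- The `α`-hook polynomial `∏_{□ ∈ lam} (α a(□) + ℓ(□) + 1)`. For the box `c` in row `c.1` and
column `c.2` (counted from `0`) the arm is `lam.rowLen c.1 - (c.2 + 1)` and the leg is
`lam.colLen c.2 - (c.1 + 1)`; neither subtraction truncates, as `c ∈ lam`. -/
def hook (lam : YoungDiagram) : QAlpha :=
  ∏ c ∈ lam.cells, (alpha * ((lam.rowLen c.1 - (c.2 + 1) : ℕ) : QAlpha)
    + ((lam.colLen c.2 - (c.1 + 1) : ℕ) : QAlpha) + 1)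

/-- The monomial symmetric polynomial `m_lam(x_1, …, x_N)` (zero if `lam` has more than `N` parts). -/
def monomialSymm (N : ℕ) (lam : YoungDiagram) : MvPolynomial (Fin N) QAlpha :=
  MvPolynomial.msymm (Fin N) QAlpha (Nat.Partition.ofMultiset (lam.rowLens : Multiset ℕ))

/-- The field `ℚ(α)(x_1, …, x_N)`. -/
abbrev RatField (N : ℕ) : Type := FractionRing (MvPolynomial (Fin N) QAlpha)

/-- The embedding of polynomials in `x_1, …, x_N` into rational functions. -/
abbrev toRat (N : ℕ) : MvPolynomial (Fin N) QAlpha →+* RatField N :=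
  algebraMap (MvPolynomial (Fin N) QAlpha) (RatField N)

/-- `D_1 f = ∑_i ∑_{j ≠ i} x_i² / (x_i - x_j) ∂f/∂x_i`, computed among rational functions. -/
def D1 (N : ℕ) (f : MvPolynomial (Fin N) QAlpha) : RatField N :=
  ∑ i : Fin N, ∑ j ∈ Finset.univ.filter (fun j : Fin N => j ≠ i),
    toRat N (MvPolynomial.X i ^ 2) / toRat N (MvPolynomial.X i - MvPolynomial.X j)
      * toRat N (MvPolynomial.pderiv i f)

/-- `D_2 f = (1/2) ∑_i x_i² ∂²f/∂x_i²`. -/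
def D2 (N : ℕ) (f : MvPolynomial (Fin N) QAlpha) : MvPolynomial (Fin N) QAlpha :=
  MvPolynomial.C (1 / 2) * ∑ i : Fin N,
    MvPolynomial.X i ^ 2 * MvPolynomial.pderiv i (MvPolynomial.pderiv i f)

/-- The Laplace–Beltrami operator `D_α = D_1 + α D_2`. -/
def laplaceBeltrami (N : ℕ) (f : MvPolynomial (Fin N) QAlpha) : RatField N :=
  D1 N f + toRat N (MvPolynomial.C alpha * D2 N f)

/-- The eigenvalue `α b(lam) - b(lamᵗ) + (N - 1) |lam|`. -/
def eigenvalue (N : ℕ) (lam : YoungDiagram) : QAlpha :=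
  alpha * (bStat lam : QAlpha) - (bStat lam.transpose : QAlpha)
    + ((N : QAlpha) - 1) * (lam.card : QAlpha)

/-- The characterization of the Jack polynomial in `N` variables indexed by `lam`. -/
structure IsJack (N : ℕ) (lam : YoungDiagram) (P : MvPolynomial (Fin N) QAlpha) : Prop where
  symmetric : P.IsSymmetric
  eigen : laplaceBeltrami N P = toRat N (MvPolynomial.C (eigenvalue N lam) * P)
  expansion : ∃ a : YoungDiagram →₀ QAlpha, (∀ nu ∈ a.support, DominanceLT nu lam) ∧
    P = MvPolynomial.C (hook lam) * monomialSymm N lam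
      + ∑ nu ∈ a.support, MvPolynomial.C (a nu) * monomialSymm N nu

open Classical in
/-- The Jack polynomial `J_lam^{(α)}(x_1, …, x_N)`: for `lam` of length at most `N` the polynomial
characterized by `IsJack`, and `0` for longer `lam` (the restriction to `N` variables of the Jack
symmetric function). -/
def jack (N : ℕ) (lam : YoungDiagram) : MvPolynomial (Fin N) QAlpha :=
  if h : lam.colLen 0 ≤ N ∧ ∃ P, IsJack N lam P then h.2.choose else 0

/-- The substitution `x_{N+1} = 0`, from `N + 1` variables to `N` variables. -/
def restrictLast (N : ℕ) :
    MvPolynomial (Fin (N + 1)) QAlpha →ₐ[QAlpha] MvPolynomial (Fin N) QAlpha :=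
  MvPolynomial.aeval (Fin.snoc (α := fun _ => MvPolynomial (Fin N) QAlpha)
    (fun i : Fin N => MvPolynomial.X i) 0)

/-! ### Cumulants -/

open Classical in
/-- The value `μ(π, {H})` of the Möbius function of the lattice of set partitions of `H`, ordered by
refinement; `⊤` is the one-block partition. -/
def moebiusTop {ι : Type*} [DecidableEq ι] {H : Finset ι} (p : Finpartition H) : ℤ :=
  letI : LocallyFiniteOrder (Finpartition H) := Fintype.toLocallyFiniteOrder
  IncidenceAlgebra.mu ℤ p ⊤

/-- The cumulant `κ_H(u) = ∑_{π ∈ 𝒫(H)} μ(π, {H}) ∏_{B ∈ π} u_B`. -/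
def cumulant {ι R : Type*} [DecidableEq ι] [CommRing R] (u : Finset ι → R) (H : Finset ι) : R :=
  ∑ p : Finpartition H, (moebiusTop p : R) * ∏ B ∈ p.parts, u B

/-- The cumulant `κ^J(lam^1, …, lam^r)` of Jack polynomials, in the variables `x_1, …, x_N`. -/
def jackCumulant (N : ℕ) {r : ℕ} (lam : Fin r → YoungDiagram) : MvPolynomial (Fin N) QAlpha :=
  cumulant (fun B => jack N (entrywiseSum lam B)) Finset.univ

/-- `f = O(α^k)` as `α → 0`: the rational function `f * α^(-k)` has no pole at `0`. -/
def IsOAlpha (k : ℤ) (f : QAlpha) : Prop :=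
  (RatFunc.denom (f * alpha ^ (-k))).eval 0 ≠ 0

end JackCumulant

end

noncomputable section

namespace JackCumulant

/-! Write u(B) for the Jack polynomial of λ^B, so that u(∅) = 1, and κ for its cumulants. For a
fixed h ∈ H one has u(H) = ∑ κ(A) u(H \ A), summed over h ∈ A ⊆ H (`conv_pointed_cumulant`), once
the Möbius function is known to be (-1)^(k-1) (k-1)! at a partition with k blocks. So κ is the
logarithm of u for the convolution of set functions, and all arguments on cumulants rest on this
recursion.

Existence and uniqueness of Jack polynomials come from triangularity. On the coefficients of a
symmetric polynomial, D_α acts by a diagonal entry plus coefficients at exponent vectors in which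
two entries have been moved apart. Such a move strictly increases the sum of all pairwise maxima
(`maxSum`), whose largest value among the vectors dominated by λ is attained only at permutations of
λ. The difference of two diagonal entries is linear in α, and its value at α = 0 is half the
difference of the `maxSum`. Hence a polynomial P is recovered from its leading coefficient and from
(D_α - e_λ) P, where e_λ is the eigenvalue, by divisions that create no pole at α = 0
(`coeffAt_mem_of_triangular`). The same recursion therefore propagates an estimate O(α^k).

For the cumulants put T_A = D_α - e_{λ^A}. Here D_1 is a derivation, D_2 is of second order, and the
eigenvalue is additive under entry-wise sums up to α ∑ λ_k μ_k. So T_{A∪B}(fg) = T_A f · g + f · T_B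
g + α Γ_{A,B}(f, g) for disjoint A and B, with Γ a derivation in its second argument. Since T_A u(A)
= 0, applying T to the recursion and cancelling u gives T_H κ(H) = -α ∑ Γ(κ(A), κ(H \ A)) over h ∈ A
⊊ H (`secondOrder_cumulant`). By induction the right side has order 1 + (|A| - 1) + (|H \ A| - 1) =
|H| - 1.

It remains to bound the leading coefficient of κ(H), which is the cumulant of the hook polynomials
(`cumulant_jack_leading`). There u(B ∪ {h}) / u(B) is a function of B whose k-th differences are
O(α^k), and this suffices (`isOAlpha_cumulant_of_ratio`). -/

/-! ### Orders of vanishing at α = 0. -/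

theorem eval_ne_zero_of_dvd {p q : Polynomial ℚ} (h : p ∣ q) (hq : q.eval 0 ≠ 0) :
    p.eval 0 ≠ 0 := by
  obtain ⟨r, rfl⟩ := h
  rw [Polynomial.eval_mul] at hq
  exact left_ne_zero_of_mul hq

theorem alpha_ne_zero : alpha ≠ 0 := RatFunc.X_ne_zero

theorem isOAlpha_zero (k : ℤ) : IsOAlpha k 0 := by
  simp [IsOAlpha]

theorem IsOAlpha.add {k : ℤ} {f g : QAlpha} (hf : IsOAlpha k f) (hg : IsOAlpha k g) :
    IsOAlpha k (f + g) := by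
  unfold IsOAlpha at *
  rw [add_mul]
  refine eval_ne_zero_of_dvd (RatFunc.denom_add_dvd _ _) ?_
  rw [Polynomial.eval_mul]
  exact mul_ne_zero hf hg

theorem IsOAlpha.mul {k l : ℤ} {f g : QAlpha} (hf : IsOAlpha k f) (hg : IsOAlpha l g) :
    IsOAlpha (k + l) (f * g) := by
  unfold IsOAlpha at *
  have : f * g * alpha ^ (-(k + l)) = (f * alpha ^ (-k)) * (g * alpha ^ (-l)) := by
    rw [neg_add, zpow_add₀ alpha_ne_zero]; ring
  rw [this]
  refine eval_ne_zero_of_dvd (RatFunc.denom_mul_dvd _ _) ?_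
  rw [Polynomial.eval_mul]
  exact mul_ne_zero hf hg

theorem isOAlpha_polynomial (p : Polynomial ℚ) :
    IsOAlpha 0 (algebraMap (Polynomial ℚ) QAlpha p) := by
  unfold IsOAlpha
  rw [neg_zero, zpow_zero, mul_one, RatFunc.denom_algebraMap]
  simp

theorem isOAlpha_algebraMap (c : ℚ) : IsOAlpha 0 (algebraMap ℚ QAlpha c) := by
  rw [IsScalarTower.algebraMap_apply ℚ (Polynomial ℚ) QAlpha]
  exact isOAlpha_polynomial _

theorem isOAlpha_natCast (c : ℕ) : IsOAlpha 0 (c : QAlpha) := by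
  simpa using isOAlpha_algebraMap (c : ℚ)

theorem isOAlpha_intCast (c : ℤ) : IsOAlpha 0 (c : QAlpha) := by
  simpa using isOAlpha_algebraMap (c : ℚ)

theorem isOAlpha_one : IsOAlpha 0 (1 : QAlpha) := by
  simpa using isOAlpha_natCast 1

theorem isOAlpha_alpha_pow (k : ℕ) : IsOAlpha k (alpha ^ k) := by
  unfold IsOAlpha
  rw [← zpow_natCast, ← zpow_add₀ alpha_ne_zero]
  simp

theorem isOAlpha_alpha : IsOAlpha 1 alpha := by
  simpa using isOAlpha_alpha_pow 1

theorem IsOAlpha.mono {k l : ℤ} {f : QAlpha} (hf : IsOAlpha k f) (h : l ≤ k) :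
    IsOAlpha l f := by
  obtain ⟨m, rfl⟩ := Int.le.dest h
  have h1 : IsOAlpha 0 (alpha ^ m) := by
    simpa [← RatFunc.algebraMap_X] using isOAlpha_polynomial (Polynomial.X ^ m)
  have := hf.mul h1
  unfold IsOAlpha at *
  have e : f * alpha ^ (-l) = f * alpha ^ m * alpha ^ (-(l + (m : ℤ) + 0)) := by
    rw [add_zero, mul_assoc, ← zpow_natCast, ← zpow_add₀ alpha_ne_zero]
    congr 2
    ring
  rwa [e]

theorem IsOAlpha.mul_left {k : ℤ} {f g : QAlpha} (hf : IsOAlpha 0 f) (hg : IsOAlpha k g) :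
    IsOAlpha k (f * g) := by
  simpa using hf.mul hg

theorem IsOAlpha.neg {k : ℤ} {f : QAlpha} (hf : IsOAlpha k f) : IsOAlpha k (-f) := by
  simpa using (isOAlpha_intCast (-1)).mul_left hf

theorem IsOAlpha.sub {k : ℤ} {f g : QAlpha} (hf : IsOAlpha k f) (hg : IsOAlpha k g) :
    IsOAlpha k (f - g) := by
  rw [sub_eq_add_neg]
  exact hf.add hg.neg

theorem isOAlpha_sum {ι : Type*} {k : ℤ} (s : Finset ι) (f : ι → QAlpha)
    (h : ∀ i ∈ s, IsOAlpha k (f i)) : IsOAlpha k (∑ i ∈ s, f i) :=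
  Finset.sum_induction f (IsOAlpha k) (fun _ _ => IsOAlpha.add) (isOAlpha_zero k) h

theorem isOAlpha_prod {ι : Type*} (s : Finset ι) (f : ι → QAlpha)
    (h : ∀ i ∈ s, IsOAlpha 0 (f i)) : IsOAlpha 0 (∏ i ∈ s, f i) :=
  Finset.prod_induction f (IsOAlpha 0) (fun _ _ h1 h2 => h1.mul_left h2) isOAlpha_one h

theorem algebraMap_add_alpha_mul (a b : ℚ) :
    algebraMap ℚ QAlpha a + alpha * algebraMap ℚ QAlpha b =
      algebraMap (Polynomial ℚ) QAlpha (Polynomial.C a + Polynomial.X * Polynomial.C b) := by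
  rw [map_add, map_mul, IsScalarTower.algebraMap_apply ℚ (Polynomial ℚ) QAlpha,
    IsScalarTower.algebraMap_apply ℚ (Polynomial ℚ) QAlpha, RatFunc.algebraMap_X]
  rfl

theorem algebraMap_add_alpha_mul_ne_zero {a : ℚ} (b : ℚ) (ha : a ≠ 0) :
    algebraMap ℚ QAlpha a + alpha * algebraMap ℚ QAlpha b ≠ 0 := by
  rw [algebraMap_add_alpha_mul]
  intro h
  rw [map_eq_zero_iff _ (RatFunc.algebraMap_injective ℚ)] at h
  have := congrArg (Polynomial.eval 0) h
  simp at this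
  exact ha this

/-- The denominator takes the value a ≠ 0 at α = 0. Every division in the estimates, in the hook
ratios as well as in the triangular system, is by factors of this form. -/
theorem isOAlpha_inv_linear {a : ℚ} (b : ℚ) (ha : a ≠ 0) :
    IsOAlpha 0 (algebraMap ℚ QAlpha a + alpha * algebraMap ℚ QAlpha b)⁻¹ := by
  have h0 := algebraMap_add_alpha_mul_ne_zero b ha
  unfold IsOAlpha
  rw [neg_zero, zpow_zero, mul_one]
  refine eval_ne_zero_of_dvd (RatFunc.denom_inv_dvd h0) ?_
  rw [algebraMap_add_alpha_mul, RatFunc.num_algebraMap]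
  simpa using ha

/-! ### The convolution algebra of set functions. -/

section Convolution

variable {ι : Type*} [DecidableEq ι]

/-- Both sides run over the ordered pairs of disjoint subsets A, C of H; on the right they are
grouped by D = A ∪ C. -/
theorem sum_powerset_sdiff_comm {M : Type*} [AddCommMonoid M] (H : Finset ι)
    (F : Finset ι → Finset ι → M) :
    ∑ A ∈ H.powerset, ∑ C ∈ (H \ A).powerset, F A C =
      ∑ D ∈ H.powerset, ∑ A ∈ D.powerset, F A (D \ A) := by
  rw [Finset.sum_sigma', Finset.sum_sigma']
  refine Finset.sum_nbij' (fun x => ⟨x.1 ∪ x.2, x.1⟩) (fun x => ⟨x.2, x.1 \ x.2⟩) ?_ ?_ ?_ ?_ ?_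
  · rintro ⟨A, C⟩ h
    simp only [Finset.mem_sigma, Finset.mem_powerset] at h ⊢
    exact ⟨Finset.union_subset h.1 (h.2.trans Finset.sdiff_subset), Finset.subset_union_left⟩
  · rintro ⟨D, A⟩ h
    simp only [Finset.mem_sigma, Finset.mem_powerset] at h ⊢
    exact ⟨h.2.trans h.1, Finset.sdiff_subset_sdiff h.1 le_rfl⟩
  · rintro ⟨A, C⟩ h
    simp only [Finset.mem_sigma, Finset.mem_powerset] at h
    have : Disjoint A C := Finset.disjoint_of_subset_right h.2 Finset.disjoint_sdiff
    simp [Finset.union_sdiff_cancel_left this]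
  · rintro ⟨D, A⟩ h
    simp only [Finset.mem_sigma, Finset.mem_powerset] at h
    simp [Finset.union_sdiff_of_subset h.2]
  · rintro ⟨A, C⟩ h
    simp only [Finset.mem_sigma, Finset.mem_powerset] at h
    have : Disjoint A C := Finset.disjoint_of_subset_right h.2 Finset.disjoint_sdiff
    simp [Finset.union_sdiff_cancel_left this]

theorem sum_powerset_sdiff {M : Type*} [AddCommMonoid M] (H : Finset ι)
    (F : Finset ι → Finset ι → M) :
    ∑ A ∈ H.powerset, F A (H \ A) = ∑ A ∈ H.powerset, F (H \ A) A := by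
  refine Finset.sum_nbij' (H \ ·) (H \ ·) ?_ ?_ ?_ ?_ ?_
  · intro A _
    simp
  · intro A _
    simp
  · intro A h
    simpa using Finset.mem_powerset.mp h
  · intro A h
    simpa using Finset.mem_powerset.mp h
  · intro A h
    rw [Finset.mem_powerset] at h
    simp [Finset.inter_eq_right.mpr h]

variable {R : Type*} [CommRing R]

/-- The convolution of set functions over decompositions of a set into two disjoint subsets. -/
def conv (f g : Finset ι → R) (H : Finset ι) : R :=
  ∑ A ∈ H.powerset, f A * g (H \ A)

theorem conv_comm (f g : Finset ι → R) : conv f g = conv g f := by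
  funext H
  unfold conv
  rw [sum_powerset_sdiff H (fun A B => f A * g B)]
  exact Finset.sum_congr rfl fun _ _ => mul_comm _ _

theorem conv_assoc (f g k : Finset ι → R) : conv (conv f g) k = conv f (conv g k) := by
  funext H
  unfold conv
  simp only [Finset.mul_sum, Finset.sum_mul]
  rw [sum_powerset_sdiff_comm H (fun A C => f A * (g C * k ((H \ A) \ C)))]
  refine Finset.sum_congr rfl fun D hD => Finset.sum_congr rfl fun A hA => ?_
  rw [Finset.mem_powerset] at hA
  rw [sdiff_sdiff_left, Finset.sup_eq_union, Finset.union_sdiff_of_subset hA, mul_assoc]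

theorem add_conv (f f' g : Finset ι → R) : conv (f + f') g = conv f g + conv f' g := by
  funext H
  simp [conv, add_mul, Finset.sum_add_distrib]

theorem conv_eq_add_sum_ssubsets (f g : Finset ι → R) (H : Finset ι) :
    conv f g H = f H * g ∅ + ∑ A ∈ H.ssubsets, f A * g (H \ A) := by
  unfold conv
  rw [← Finset.insert_erase (Finset.mem_powerset_self H),
    Finset.sum_insert (Finset.notMem_erase _ _), Finset.sdiff_self]
  rfl

/-- Convolution with u is unitriangular for inclusion because u ∅ = 1. Only the subsets of H enter,
so identities known locally can be cancelled. -/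
theorem conv_right_cancel {f g u : Finset ι → R} (hu : u ∅ = 1) {H : Finset ι}
    (h : ∀ B ⊆ H, conv f u B = conv g u B) : ∀ B ⊆ H, f B = g B := by
  intro B
  induction B using Finset.strongInduction with
  | H B ih =>
    intro hB
    have := h B hB
    rw [conv_eq_add_sum_ssubsets, conv_eq_add_sum_ssubsets, hu, mul_one, mul_one] at this
    rw [Finset.sum_congr rfl fun A hA => by
      rw [ih A (Finset.mem_ssubsets.mp hA) ((Finset.mem_ssubsets.mp hA).subset.trans hB)]] at this
    exact add_right_cancel this

/-- The restriction of a set function to the sets that contain `h`. -/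
def pointed (h : ι) (f : Finset ι → R) (A : Finset ι) : R := if h ∈ A then f A else 0

/-- A point h ∈ H lies in exactly one of A and H \ A. In terms of square-free generating functions,
`pointed h` is the derivation x_h ∂/∂x_h. -/
theorem pointed_conv (h : ι) (f g : Finset ι → R) :
    pointed h (conv f g) = conv (pointed h f) g + conv f (pointed h g) := by
  funext H
  simp only [Pi.add_apply, conv, pointed, ← Finset.sum_add_distrib]
  split_ifs with hH
  · refine Finset.sum_congr rfl fun A _ => ?_
    by_cases hA : h ∈ A <;> simp [hA, hH]
  · refine (Finset.sum_eq_zero fun A hA => ?_).symm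
    have : h ∉ A := fun hh => hH (Finset.mem_powerset.mp hA hh)
    simp [this, hH]

end Convolution

/-! ### The Möbius function of the partition lattice and the recursion for cumulants. -/

section Moebius

variable {ι : Type*} [DecidableEq ι]

/-- The value of the Möbius function of the partition lattice between a partition with `k` blocks
and the one-block partition. -/
def moebiusCoeff (k : ℕ) : ℤ := (-1) ^ (k - 1) * ((k - 1).factorial : ℤ)

/-- This cancellation removes all partitions with at least two blocks in
`conv_pointed_explicitCumulant`. -/
theorem moebiusCoeff_add {k : ℕ} (hk : 2 ≤ k) :
    moebiusCoeff k + ((k - 1 : ℕ) : ℤ) * moebiusCoeff (k - 1) = 0 := by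
  obtain ⟨m, rfl⟩ := Nat.exists_eq_add_of_le' hk
  simp only [moebiusCoeff, Nat.add_one_sub_one, Nat.factorial_succ]
  push_cast
  ring

variable {R : Type*} [CommRing R]

/-- The cumulant with explicit coefficients in place of the Möbius function. -/
def explicitCumulant (u : Finset ι → R) (H : Finset ι) : R :=
  ∑ p : Finpartition H, (moebiusCoeff p.parts.card : R) * ∏ B ∈ p.parts, u B

/-- The partition that remains after a block is removed. -/
def removePart {H : Finset ι} (p : Finpartition H) {C : Finset ι} (hC : C ∈ p.parts) :
    Finpartition (H \ C) where
  parts := p.parts.erase C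
  supIndep := p.supIndep.subset (Finset.erase_subset _ _)
  sup_parts := by
    ext x
    simp only [Finset.mem_sup, Finset.mem_erase, id_eq, Finset.mem_sdiff]
    constructor
    · rintro ⟨B, ⟨hBC, hB⟩, hx⟩
      exact ⟨p.subset hB hx, fun hxC => hBC (p.eq_of_mem_parts hB hC hx hxC)⟩
    · rintro ⟨hx, hxC⟩
      obtain ⟨B, hB, hxB⟩ := p.exists_mem hx
      exact ⟨B, ⟨fun h => hxC (h ▸ hxB), hB⟩, hxB⟩
  bot_notMem := fun h => p.bot_notMem (Finset.mem_of_mem_erase h)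

theorem notMem_parts_of_disjoint {A C : Finset ι} (p : Finpartition A) (hC : C.Nonempty)
    (h : Disjoint A C) : C ∉ p.parts := fun hp => by
  obtain ⟨x, hx⟩ := hC
  exact Finset.disjoint_left.mp h (p.subset hp hx) hx

/-- Adjoin the block H \ A to a partition of A, where h ∈ A. A partition of H arises in this way
once for each of its blocks that avoid h, that is, one time less than its number of blocks, and the
partition of A has one block fewer. -/
theorem sum_ssubsets_explicitCumulant_mul (u : Finset ι → R) {H : Finset ι} {h : ι} (hh : h ∈ H) :
    ∑ A ∈ H.ssubsets, pointed h (explicitCumulant u) A * u (H \ A) =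
      ∑ p : Finpartition H, (((p.parts.card - 1 : ℕ) : ℤ) * moebiusCoeff (p.parts.card - 1) : ℤ) *
        ∏ B ∈ p.parts, u B := by
  have e1 : ∑ A ∈ H.ssubsets, pointed h (explicitCumulant u) A * u (H \ A) =
      ∑ A ∈ H.ssubsets.filter (h ∈ ·), ∑ p : Finpartition A,
        (moebiusCoeff p.parts.card : R) * (∏ B ∈ p.parts, u B) * u (H \ A) := by
    rw [Finset.sum_filter]
    refine Finset.sum_congr rfl fun A _ => ?_
    unfold pointed explicitCumulant
    split_ifs
    · rw [Finset.sum_mul]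
    · rw [zero_mul]
  have e2 : ∀ p : Finpartition H,
      ((((p.parts.card - 1 : ℕ) : ℤ) * moebiusCoeff (p.parts.card - 1) : ℤ) : R) *
        ∏ B ∈ p.parts, u B =
      ∑ C ∈ p.parts.filter (h ∉ ·), (moebiusCoeff (p.parts.card - 1) : R) *
        ∏ B ∈ p.parts, u B := by
    intro p
    have hc : (p.parts.filter (h ∉ ·)) = p.parts.erase (p.part h) := by
      ext C
      simp only [Finset.mem_filter, Finset.mem_erase]
      constructor
      · rintro ⟨h1, h2⟩
        exact ⟨fun e => h2 (e ▸ p.mem_part_self.mpr hh), h1⟩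
      · rintro ⟨h1, h2⟩
        exact ⟨h2, fun e => h1 (p.part_eq_of_mem h2 e).symm⟩
    rw [Finset.sum_const, hc, Finset.card_erase_of_mem (p.part_mem.mpr hh), nsmul_eq_mul]
    push_cast
    ring
  rw [e1, Finset.sum_congr rfl fun p _ => e2 p, Finset.sum_sigma', Finset.sum_sigma']
  refine Finset.sum_bij
    (fun x hx => ⟨x.2.extend (b := H \ x.1) (c := H)
      (by
        simp only [Finset.mem_sigma, Finset.mem_filter, Finset.mem_ssubsets] at hx
        exact (Finset.sdiff_nonempty.mpr hx.1.1.2).ne_empty)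
      Finset.disjoint_sdiff
      (by
        simp only [Finset.mem_sigma, Finset.mem_filter, Finset.mem_ssubsets] at hx
        exact Finset.union_sdiff_of_subset hx.1.1.1), H \ x.1⟩) ?_ ?_ ?_ ?_
  · rintro ⟨A, p⟩ hx
    simp only [Finset.mem_sigma, Finset.mem_filter, Finset.mem_ssubsets] at hx
    simp [Finpartition.extend, hx.1.2]
  · rintro ⟨A, p⟩ hx ⟨A', p'⟩ hx' heq
    simp only [Finset.mem_sigma, Finset.mem_filter, Finset.mem_ssubsets] at hx hx'
    rw [Sigma.mk.injEq] at heq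
    obtain ⟨h1, h2⟩ := heq
    have h2 := eq_of_heq h2
    have hA : A = A' := by
      rw [← Finset.sdiff_sdiff_eq_self hx.1.1.1, h2, Finset.sdiff_sdiff_eq_self hx'.1.1.1]
    subst hA
    have h3 := congrArg Finpartition.parts h1
    simp only [Finpartition.extend] at h3
    have hne : (H \ A).Nonempty := Finset.sdiff_nonempty.mpr hx.1.1.2
    have h4 : p.parts = p'.parts := by
      rw [← Finset.erase_insert (notMem_parts_of_disjoint p hne Finset.disjoint_sdiff), h3,
        Finset.erase_insert (notMem_parts_of_disjoint p' hne Finset.disjoint_sdiff)]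
    rw [Finpartition.ext h4]
  · rintro ⟨p, C⟩ hx
    simp only [Finset.mem_sigma, Finset.mem_univ, Finset.mem_filter, true_and] at hx
    have hCH : C ⊆ H := p.subset hx.1
    have hCn : C.Nonempty := p.nonempty_of_mem_parts hx.1
    refine ⟨⟨H \ C, removePart p hx.1⟩, ?_, ?_⟩
    · simp only [Finset.mem_sigma, Finset.mem_filter, Finset.mem_ssubsets, Finset.mem_univ,
        and_true, Finset.mem_sdiff]
      exact ⟨Finset.sdiff_ssubset hCH hCn, hh, hx.2⟩
    · rw [Sigma.mk.injEq]
      refine ⟨Finpartition.ext ?_, heq_of_eq (Finset.sdiff_sdiff_eq_self hCH)⟩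
      simp only [Finpartition.extend, removePart, Finset.sdiff_sdiff_eq_self hCH]
      exact Finset.insert_erase hx.1
  · rintro ⟨A, p⟩ hx
    simp only [Finset.mem_sigma, Finset.mem_filter, Finset.mem_ssubsets] at hx
    have hne : (H \ A).Nonempty := Finset.sdiff_nonempty.mpr hx.1.1.2
    have hn := notMem_parts_of_disjoint p hne Finset.disjoint_sdiff
    simp only [Finpartition.extend]
    rw [Finset.card_insert_of_notMem hn, Finset.prod_insert hn, Nat.add_sub_cancel]
    ring

/-- A partition of H with k ≥ 2 blocks has total coefficient μ_k + (k-1) μ_{k-1} = 0; the one-block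
partition leaves u H. -/
theorem conv_pointed_explicitCumulant {u : Finset ι → R} (hu : u ∅ = 1) {H : Finset ι} {h : ι}
    (hh : h ∈ H) : conv (pointed h (explicitCumulant u)) u H = u H := by
  rw [conv_eq_add_sum_ssubsets, hu, mul_one, sum_ssubsets_explicitCumulant_mul u hh]
  rw [pointed, if_pos hh, explicitCumulant, ← Finset.sum_add_distrib]
  have hne : H ≠ ⊥ := Finset.ne_empty_of_mem hh
  rw [Finset.sum_eq_single (Finpartition.indiscrete hne)]
  · simp [Finpartition.indiscrete, moebiusCoeff]
  · intro p _ hp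
    rw [← add_mul, ← Int.cast_add]
    have h1 : 1 ≤ p.parts.card := Finset.card_pos.mpr (p.parts_nonempty hne)
    have h2 : p.parts.card ≠ 1 := by
      intro hc
      obtain ⟨B, hB⟩ := Finset.card_eq_one.mp hc
      refine hp (Finpartition.ext ?_)
      have := p.sup_parts
      rw [hB, Finset.sup_singleton, id] at this
      rw [hB, this]
      rfl
    rw [moebiusCoeff_add (by omega), Int.cast_zero, zero_mul]
  · simp

/-- The set function here is the indicator of "every block of p is inside C or disjoint from C". By
induction, the only proper subset A of B that can contribute to the recursion is the block of h. If
this block is properly inside B, its contribution cancels u B, since removing a whole block does not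
change the indicator. -/
theorem explicitCumulant_blocks {H : Finset ι} (p : Finpartition H) {B : Finset ι}
    (hB : B.Nonempty) (hBH : B ⊆ H) :
    explicitCumulant (fun C => if ∀ D ∈ p.parts, D ⊆ C ∨ Disjoint D C then (1 : ℤ) else 0) B =
      if B ∈ p.parts then 1 else 0 := by
  set u : Finset ι → ℤ := fun C => if ∀ D ∈ p.parts, D ⊆ C ∨ Disjoint D C then (1 : ℤ) else 0
    with hudef
  induction B using Finset.strongInduction with
  | H B ih =>
    obtain ⟨h, hh⟩ := hB
    have hu : u ∅ = 1 := by simp [hudef]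
    have hHh := hBH hh
    have hB0 := p.part_mem.mpr hHh
    have hhB0 := p.mem_part_self.mpr hHh
    set B0 := p.part h with hB0def
    have key := conv_pointed_explicitCumulant hu hh
    rw [conv_eq_add_sum_ssubsets, hu, mul_one, pointed, if_pos hh] at key
    have e : ∑ A ∈ B.ssubsets, pointed h (explicitCumulant u) A * u (B \ A) =
        if B0 ⊂ B then u (B \ B0) else 0 := by
      have : ∀ A ∈ B.ssubsets, pointed h (explicitCumulant u) A * u (B \ A) =
          if A = B0 then u (B \ B0) else 0 := by
        intro A hA
        rw [Finset.mem_ssubsets] at hA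
        unfold pointed
        by_cases hhA : h ∈ A
        · rw [if_pos hhA, ih A hA ⟨h, hhA⟩ (hA.subset.trans hBH)]
          by_cases hAB : A = B0
          · rw [if_pos (hAB ▸ hB0), if_pos hAB, hAB, one_mul]
          · rw [if_neg hAB, if_neg, zero_mul]
            exact fun hp => hAB (p.part_eq_of_mem hp hhA).symm
        · rw [if_neg hhA, zero_mul, if_neg]
          rintro rfl
          exact hhA hhB0
      rw [Finset.sum_congr rfl this, Finset.sum_ite_eq']
      simp only [Finset.mem_ssubsets]
    rw [e] at key
    by_cases hBp : B ∈ p.parts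
    · have hBB : B0 = B := p.part_eq_of_mem hBp hh
      rw [if_neg (by rw [hBB]; exact fun h => h.ne rfl), add_zero] at key
      rw [key, if_pos hBp, hudef]
      simp only
      rw [if_pos]
      intro D hD
      by_cases hDB : D = B
      · exact Or.inl hDB.le
      · exact Or.inr (p.disjoint hD hBp hDB)
    · rw [if_neg hBp]
      have hne : B0 ≠ B := fun e => hBp (e ▸ hB0)
      by_cases hsub : B0 ⊆ B
      · rw [if_pos (Finset.ssubset_iff_subset_ne.mpr ⟨hsub, hne⟩)] at key
        have : u (B \ B0) = u B := by
          simp only [hudef]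
          congr 1
          refine propext ⟨fun H1 D hD => ?_, fun H1 D hD => ?_⟩
          · by_cases hDB : D = B0
            · exact Or.inl (hDB ▸ hsub)
            · have hdis : Disjoint D B0 := p.disjoint hD hB0 hDB
              rcases H1 D hD with h1 | h1
              · exact Or.inl (h1.trans Finset.sdiff_subset)
              · right
                rw [← Finset.sdiff_union_of_subset hsub, Finset.disjoint_union_right]
                exact ⟨h1, hdis⟩
          · by_cases hDB : D = B0
            · exact Or.inr (hDB ▸ Finset.disjoint_sdiff)
            · have hdis : Disjoint D B0 := p.disjoint hD hB0 hDB
              rcases H1 D hD with h1 | h1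
              · exact Or.inl (Finset.subset_sdiff.mpr ⟨h1, hdis⟩)
              · exact Or.inr (h1.mono_right Finset.sdiff_subset)
        rw [this] at key
        linarith
      · rw [if_neg (fun h => hsub h.subset), add_zero] at key
        rw [key, hudef]
        simp only
        rw [if_neg]
        intro H1
        rcases H1 B0 hB0 with h1 | h1
        · exact hsub h1
        · exact Finset.disjoint_left.mp h1 hhB0 hh

open Classical in
-- The product over the blocks of q of the indicator in `explicitCumulant_blocks` is the indicator
-- of p ≤ q, so the sum is an explicit cumulant at H.
theorem sum_moebiusCoeff_of_le {H : Finset ι} (hH : H.Nonempty) (p : Finpartition H) :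
    (∑ q : Finpartition H, if p ≤ q then moebiusCoeff q.parts.card else 0) =
      if H ∈ p.parts then 1 else 0 := by
  rw [← explicitCumulant_blocks p hH subset_rfl, explicitCumulant]
  refine Finset.sum_congr rfl fun q _ => ?_
  rw [Int.cast_id, Finset.prod_ite_zero]
  simp only [Finset.prod_const_one, mul_ite, mul_one, mul_zero]
  congr 1
  refine propext ⟨fun hpq C hC D hD => ?_, fun h D hD => ?_⟩
  · obtain ⟨C', hC', hDC'⟩ := hpq hD
    by_cases hCC : C' = C
    · exact Or.inl (hCC ▸ hDC')
    · exact Or.inr ((q.disjoint hC' hC hCC).mono_left hDC')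
  · obtain ⟨x, hx⟩ := p.nonempty_of_mem_parts hD
    obtain ⟨C, hC, hxC⟩ := q.exists_mem (p.subset hD hx)
    refine ⟨C, hC, ?_⟩
    rcases h C hC D hD with h1 | h1
    · exact h1
    · exact absurd hxC (Finset.disjoint_left.mp h1 hx)

theorem mem_parts_iff_eq_top {H : Finset ι} (hH : H.Nonempty) (p : Finpartition H) :
    H ∈ p.parts ↔ p = ⊤ := by
  constructor
  · intro h
    refine top_le_iff.mp fun B _ => ⟨H, h, (⊤ : Finpartition H).subset ‹_›⟩
  · rintro rfl
    have h1 := Finpartition.parts_top_subset H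
    obtain ⟨x, hx⟩ := (⊤ : Finpartition H).parts_nonempty hH.ne_empty
    have := Finset.mem_singleton.mp (h1 hx)
    exact this ▸ hx

open Classical in
-- Both functions have the same sum over every interval from p to ⊤, and these sums determine a
-- function by induction downward from ⊤.
theorem moebiusTop_eq {H : Finset ι} (hH : H.Nonempty) (p : Finpartition H) :
    moebiusTop p = moebiusCoeff p.parts.card := by
  let : LocallyFiniteOrder (Finpartition H) := Fintype.toLocallyFiniteOrder
  have key : ∀ p : Finpartition H, ∑ q ∈ Finset.Icc p ⊤, moebiusTop q =
      ∑ q ∈ Finset.Icc p ⊤, moebiusCoeff q.parts.card := by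
    intro p
    have h1 : ∑ q ∈ Finset.Icc p ⊤, moebiusTop q = if p = ⊤ then 1 else 0 :=
      IncidenceAlgebra.sum_Icc_mu_left (𝕜 := ℤ) p ⊤
    have h2 := sum_moebiusCoeff_of_le hH p
    rw [h1, ← if_congr (mem_parts_iff_eq_top hH p) rfl rfl, ← h2, ← Finset.sum_filter]
    refine Finset.sum_congr ?_ fun _ _ => rfl
    ext q
    simp
  induction p using WellFoundedGT.induction with
  | ind p ih =>
    have := key p
    rw [← Finset.Ioc_insert_left (le_top : p ≤ ⊤), Finset.sum_insert (by simp),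
      Finset.sum_insert (by simp), Finset.sum_congr rfl fun q hq => ih q (Finset.mem_Ioc.mp hq).1]
      at this
    exact add_right_cancel this

theorem cumulant_eq_explicitCumulant (u : Finset ι → R) {H : Finset ι} (hH : H.Nonempty) :
    cumulant u H = explicitCumulant u H :=
  Finset.sum_congr rfl fun p _ => by rw [moebiusTop_eq hH]

/-- The recursion that determines cumulants: `u H` is the sum of `κ_B u (H \ B)` over the subsets
`B` of `H` that contain a given point. -/
theorem conv_pointed_cumulant {u : Finset ι → R} (hu : u ∅ = 1) {H : Finset ι} {h : ι}
    (hh : h ∈ H) : conv (pointed h (cumulant u)) u H = u H := by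
  rw [← conv_pointed_explicitCumulant hu hh]
  congr 1
  funext A
  unfold pointed
  split_ifs with hA
  · exact cumulant_eq_explicitCumulant u ⟨h, hA⟩
  · rfl

theorem conv_pointed_cumulant_eq_pointed {u : Finset ι → R} (hu : u ∅ = 1) (h : ι) :
    conv (pointed h (cumulant u)) u = pointed h u := by
  funext H
  by_cases hh : h ∈ H
  · rw [conv_pointed_cumulant hu hh, pointed, if_pos hh]
  · rw [pointed, if_neg hh]
    refine Finset.sum_eq_zero fun A hA => ?_
    rw [pointed, if_neg fun hA' => hh (Finset.mem_powerset.mp hA hA'), zero_mul]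

end Moebius

/-! ### Derivations and second-order operators acting on cumulants. -/

section Evolution

variable {ι : Type*} [DecidableEq ι] {R S : Type*} [CommRing R] [CommRing S]

/-- The cumulants, with the value at the empty set replaced by `0`. -/
def reducedCumulant (u : Finset ι → R) (H : Finset ι) : R := if H = ∅ then 0 else cumulant u H

theorem pointed_reducedCumulant (u : Finset ι → R) (h : ι) :
    pointed h (reducedCumulant u) = pointed h (cumulant u) := by
  funext A
  unfold pointed reducedCumulant
  split_ifs with h1 h2
  · simp [h2] at h1
  · rfl
  · rfl

/-- The logarithmic derivative of a set function with respect to a graded derivation. -/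
theorem gradedDerivation_eq_conv (d : Finset ι → R →+ R)
    (hd : ∀ B C, Disjoint B C → ∀ x y, d (B ∪ C) (x * y) = d B x * y + x * d C y)
    {u : Finset ι → R} (hu : u ∅ = 1) (B : Finset ι) :
    d B (u B) = conv (fun C => d C (reducedCumulant u C)) u B := by
  have hconv : ∀ f g : Finset ι → R, ∀ B, d B (conv f g B) =
      conv (fun C => d C (f C)) g B + conv f (fun C => d C (g C)) B := by
    intro f g B
    simp only [conv, map_sum, ← Finset.sum_add_distrib]
    refine Finset.sum_congr rfl fun A hA => ?_
    rw [← hd _ _ Finset.disjoint_sdiff,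
      Finset.union_sdiff_of_subset (Finset.mem_powerset.mp hA)]
  set dk : Finset ι → R := fun C => d C (reducedCumulant u C) with hdk
  induction B using Finset.strongInduction with
  | H B ih =>
    rcases B.eq_empty_or_nonempty with rfl | ⟨h, hh⟩
    -- The product rule for 1 · 1 forces `d ∅ 1 = 0`.
    · have := hd ∅ ∅ (Finset.disjoint_empty_left _) 1 1
      simp only [Finset.union_self, mul_one, one_mul, left_eq_add] at this
      simp [conv, hdk, reducedCumulant, hu, this]
    · have hpt : (fun C => d C (pointed h (cumulant u) C)) = pointed h dk := by
        rw [← pointed_reducedCumulant]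
        funext C
        unfold pointed
        split_ifs
        · rfl
        · exact map_zero _
      -- Apply d to the recursion for u. The candidate `conv dk u` satisfies the same recursion by
      -- `pointed_conv`, and the remaining terms live on sets without h, where induction applies.
      have h1 : d B (u B) = conv (pointed h dk) u B +
          conv (pointed h (cumulant u)) (fun C => d C (u C)) B := by
        rw [← hpt, ← hconv, conv_pointed_cumulant hu hh]
      have h2 : conv dk u B = conv (pointed h dk) u B +
          conv (pointed h (cumulant u)) (conv dk u) B := by
        have e : pointed h (conv dk u) B = conv dk u B := if_pos hh
        rw [← e, pointed_conv, ← conv_pointed_cumulant_eq_pointed hu h, ← conv_assoc,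
          conv_comm dk, conv_assoc]
        rfl
      rw [h1, h2]
      congr 1
      refine Finset.sum_congr rfl fun A hA => ?_
      unfold pointed
      split_ifs with hhA
      · simp only
        rw [ih _ (Finset.sdiff_ssubset (Finset.mem_powerset.mp hA) ⟨h, hhA⟩)]
      · simp

/-- If a family of second-order operators annihilates a set function, then its action on the
cumulants is quadratic in cumulants of smaller sets. -/
theorem secondOrder_cumulant (φ : R →+* S) (T : Finset ι → R →+ S)
    (Γ : Finset ι → Finset ι → R →+ R →+ R) (c : R)
    (hT : ∀ A B, Disjoint A B → ∀ f g,
      T (A ∪ B) (f * g) = T A f * φ g + φ f * T B g + φ (c * Γ A B f g))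
    (hΓ : ∀ A B C, Disjoint B C → ∀ f g k,
      Γ A (B ∪ C) f (g * k) = Γ A B f g * k + g * Γ A C f k)
    {u : Finset ι → R} (hu : u ∅ = 1) (hTu : ∀ H, T H (u H) = 0) {H : Finset ι} {h : ι}
    (hh : h ∈ H) :
    T H (cumulant u H) = -φ (c * ∑ A ∈ H.powerset,
      Γ A (H \ A) (pointed h (cumulant u) A) (reducedCumulant u (H \ A))) := by
  set E : Finset ι → R := fun D => ∑ A ∈ D.powerset,
      Γ A (D \ A) (pointed h (cumulant u) A) (reducedCumulant u (D \ A)) with hE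
  -- For fixed A, the map Γ A · (κ_A) is a graded derivation, so its value at u is its value at the
  -- cumulants convolved with u. Regrouping by D = A ∪ C factors u out of the whole sum.
  have hE' : ∀ B, ∑ A ∈ B.powerset, Γ A (B \ A) (pointed h (cumulant u) A) (u (B \ A)) =
      conv E u B := by
    intro B
    have : ∀ A ∈ B.powerset, Γ A (B \ A) (pointed h (cumulant u) A) (u (B \ A)) =
        ∑ C ∈ (B \ A).powerset, Γ A C (pointed h (cumulant u) A) (reducedCumulant u C) *
          u ((B \ A) \ C) := fun A _ =>
      gradedDerivation_eq_conv (fun C => Γ A C (pointed h (cumulant u) A))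
        (fun C C' hC x y => hΓ A C C' hC _ x y) hu (B \ A)
    rw [Finset.sum_congr rfl this, sum_powerset_sdiff_comm B (fun A C =>
      Γ A C (pointed h (cumulant u) A) (reducedCumulant u C) * u ((B \ A) \ C))]
    unfold conv
    refine Finset.sum_congr rfl fun D _ => ?_
    rw [hE, Finset.sum_mul]
    refine Finset.sum_congr rfl fun A hA => ?_
    rw [sdiff_sdiff_left, Finset.sup_eq_union,
      Finset.union_sdiff_of_subset (Finset.mem_powerset.mp hA)]
  -- Apply T B to the recursion for the pointed u: the terms in which T falls on u vanish, and what
  -- is left is a convolution with u that equals zero, so u can be cancelled.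
  have key : ∀ B ⊆ H, conv (fun A => T A (pointed h (cumulant u) A) + φ (c * E A)) (φ ∘ u) B =
      conv 0 (φ ∘ u) B := by
    intro B _
    have h0 : T B (conv (pointed h (cumulant u)) u B) = 0 := by
      rw [conv_pointed_cumulant_eq_pointed hu, pointed]
      split_ifs
      · exact hTu B
      · exact map_zero _
    have h1 : T B (conv (pointed h (cumulant u)) u B) =
        conv (fun A => T A (pointed h (cumulant u) A)) (φ ∘ u) B +
          φ (c * ∑ A ∈ B.powerset, Γ A (B \ A) (pointed h (cumulant u) A) (u (B \ A))) := by
      simp only [conv, map_sum, Finset.mul_sum, ← Finset.sum_add_distrib]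
      refine Finset.sum_congr rfl fun A hA => ?_
      have := hT A (B \ A) Finset.disjoint_sdiff (pointed h (cumulant u) A) (u (B \ A))
      rw [Finset.union_sdiff_of_subset (Finset.mem_powerset.mp hA), hTu, mul_zero, add_zero]
        at this
      exact this
    rw [hE'] at h1
    have h2 : φ (c * conv E u B) = conv (fun A => φ (c * E A)) (φ ∘ u) B := by
      simp only [conv, map_sum, Finset.mul_sum]
      refine Finset.sum_congr rfl fun A _ => ?_
      simp [mul_assoc]
    rw [h2, h0] at h1
    have h3 : conv (0 : Finset ι → S) (φ ∘ u) B = 0 := by simp [conv]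
    rw [h3, h1]
    exact congrFun (add_conv _ _ _) B
  have := conv_right_cancel (u := φ ∘ u) (by simp [hu]) key H subset_rfl
  simp only [Pi.zero_apply] at this
  rw [pointed, if_pos hh] at this
  exact eq_neg_of_add_eq_zero_left this

end Evolution

/-! ### Small differences and a ratio criterion for small cumulants. -/

section Smallness

variable {ι : Type*}

/-- Set functions whose differences of order `k` are `O(α^k)`. -/
def HasSmallDifferences (v : Finset ι → QAlpha) : Prop :=
  ∃ w : Finset ι → QAlpha, (∀ A, IsOAlpha A.card (w A)) ∧ ∀ B, v B = ∑ A ∈ B.powerset, w A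

/-- The function is additive in B, so only its first differences α n_i are nonzero. -/
theorem hasSmallDifferences_sum (n : ι → ℕ) :
    HasSmallDifferences fun B : Finset ι => alpha * ((∑ i ∈ B, n i : ℕ) : QAlpha) := by
  refine ⟨fun A => if A.card = 1 then alpha * ((∑ i ∈ A, n i : ℕ) : QAlpha) else 0,
    fun A => ?_, fun B => ?_⟩
  · dsimp only
    split_ifs with h
    · rw [h, mul_comm]
      exact (isOAlpha_natCast _).mul_left isOAlpha_alpha
    · exact isOAlpha_zero _
  · rw [← Finset.sum_filter, ← Finset.powersetCard_eq_filter, Finset.powersetCard_one,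
      Finset.sum_map]
    simp [Finset.mul_sum]

theorem HasSmallDifferences.add {v v' : Finset ι → QAlpha} (h : HasSmallDifferences v)
    (h' : HasSmallDifferences v') : HasSmallDifferences fun B => v B + v' B := by
  obtain ⟨w, hw, hv⟩ := h
  obtain ⟨w', hw', hv'⟩ := h'
  exact ⟨fun A => w A + w' A, fun A => (hw A).add (hw' A), fun B => by
    simp only [hv, hv', Finset.sum_add_distrib]⟩

variable [DecidableEq ι]

theorem exists_sum_powerset_eq (v : Finset ι → QAlpha) :
    ∃ w : Finset ι → QAlpha, ∀ B, v B = ∑ A ∈ B.powerset, w A := by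
  let w : Finset ι → QAlpha := Finset.strongInduction fun B ih =>
    v B - ∑ A ∈ B.ssubsets.attach, ih A.1 (Finset.mem_ssubsets.mp A.2)
  refine ⟨w, fun B => ?_⟩
  have hw : w B = v B - ∑ A ∈ B.ssubsets.attach, w A.1 := Finset.strongInduction_eq _ _
  rw [Finset.sum_attach B.ssubsets w] at hw
  rw [← Finset.insert_erase (Finset.mem_powerset_self B),
    Finset.sum_insert (Finset.notMem_erase _ _)]
  change v B = w B + ∑ A ∈ B.ssubsets, w A
  rw [hw, sub_add_cancel]

theorem eq_of_sum_powerset_eq {f g : Finset ι → QAlpha}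
    (h : ∀ B : Finset ι, ∑ A ∈ B.powerset, f A = ∑ A ∈ B.powerset, g A) (C : Finset ι) :
    f C = g C := by
  refine conv_right_cancel (u := fun _ => (1 : QAlpha)) rfl (H := C) (fun B _ => ?_) C subset_rfl
  simpa [conv] using h B

theorem hasSmallDifferences_const {c : QAlpha} (hc : IsOAlpha 0 c) :
    HasSmallDifferences fun _ : Finset ι => c := by
  refine ⟨fun A => if A = ∅ then c else 0, fun A => ?_, fun B => ?_⟩
  · dsimp only
    split_ifs with h
    · simpa [h] using hc
    · exact isOAlpha_zero _
  · simp

theorem sum_powerset_mul_sum_powerset (w w' : Finset ι → QAlpha) (B : Finset ι) :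
    (∑ A ∈ B.powerset, w A) * ∑ A ∈ B.powerset, w' A = ∑ C ∈ B.powerset,
      ∑ A' ∈ C.powerset, ∑ A ∈ C.powerset.filter (fun A => A ∪ A' = C), w A * w' A' := by
  rw [mul_comm, Finset.sum_mul_sum, ← Finset.sum_product',
    ← Finset.sum_fiberwise_of_maps_to (t := B.powerset) (g := fun x => x.2 ∪ x.1)]
  · refine Finset.sum_congr rfl fun C hC => ?_
    rw [Finset.mem_powerset] at hC
    rw [Finset.sum_sigma']
    refine Finset.sum_nbij' (fun x => ⟨x.1, x.2⟩) (fun x => (x.1, x.2)) ?_ ?_ ?_ ?_ ?_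
    · rintro ⟨A, A'⟩ h
      simp only [Finset.mem_filter, Finset.mem_product, Finset.mem_powerset,
        Finset.mem_sigma] at h ⊢
      refine ⟨?_, ?_, h.2⟩
      · rw [← h.2]; exact Finset.subset_union_right
      · rw [← h.2]; exact Finset.subset_union_left
    · rintro ⟨A, A'⟩ h
      simp only [Finset.mem_filter, Finset.mem_product, Finset.mem_powerset,
        Finset.mem_sigma] at h ⊢
      exact ⟨⟨h.1.trans hC, h.2.1.trans hC⟩, h.2.2⟩
    · intro _ _; rfl
    · intro _ _; rfl
    · intro _ _; exact mul_comm _ _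
  · rintro ⟨A, A'⟩ h
    simp only [Finset.mem_product, Finset.mem_powerset] at h ⊢
    exact Finset.union_subset h.2 h.1

/-- The difference of a product at C collects the pairs with A ∪ A' = C, and then |C| ≤ |A| + |A'|.
-/
theorem HasSmallDifferences.mul {v v' : Finset ι → QAlpha} (h : HasSmallDifferences v)
    (h' : HasSmallDifferences v') : HasSmallDifferences fun B => v B * v' B := by
  obtain ⟨w, hw, hv⟩ := h
  obtain ⟨w', hw', hv'⟩ := h'
  refine ⟨fun C => ∑ A' ∈ C.powerset, ∑ A ∈ C.powerset.filter (fun A => A ∪ A' = C), w A * w' A',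
    fun C => ?_, fun B => ?_⟩
  · refine isOAlpha_sum _ _ fun A' _ => isOAlpha_sum _ _ fun A hA => ?_
    refine ((hw A).mul (hw' A')).mono ?_
    rw [← (Finset.mem_filter.mp hA).2]
    exact_mod_cast Finset.card_union_le A A'
  · simp only [hv, hv', sum_powerset_mul_sum_powerset]

theorem HasSmallDifferences.prod {κ : Type*} (s : Finset κ) (v : κ → Finset ι → QAlpha)
    (h : ∀ k ∈ s, HasSmallDifferences (v k)) :
    HasSmallDifferences fun B => ∏ k ∈ s, v k B := by
  classical
  induction s using Finset.induction_on with
  | empty => simpa using hasSmallDifferences_const isOAlpha_one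
  | insert a s ha ih =>
    simp only [Finset.prod_insert ha]
    exact (h a (Finset.mem_insert_self _ _)).mul
      (ih fun k hk => h k (Finset.mem_insert_of_mem hk))

/-- Solve v · v⁻¹ = 1 for the differences w' of v⁻¹. In the equation at C the unknown w' C has
coefficient ∑ w A over A ⊆ C, which is v C; all other terms involve w' at smaller sets. -/
theorem HasSmallDifferences.inv {v : Finset ι → QAlpha} (h : HasSmallDifferences v)
    (h0 : ∀ B, v B ≠ 0) (hinv : ∀ B, IsOAlpha 0 (v B)⁻¹) :
    HasSmallDifferences fun B => (v B)⁻¹ := by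
  obtain ⟨w, hw, hv⟩ := h
  obtain ⟨w', hw'⟩ := exists_sum_powerset_eq fun B => (v B)⁻¹
  refine ⟨w', fun C => ?_, hw'⟩
  have key : ∀ C : Finset ι, ∑ A' ∈ C.powerset, ∑ A ∈ C.powerset.filter (fun A => A ∪ A' = C),
      w A * w' A' = if C = ∅ then 1 else 0 := by
    refine eq_of_sum_powerset_eq fun B => ?_
    rw [← sum_powerset_mul_sum_powerset, ← hv, ← hw', mul_inv_cancel₀ (h0 B)]
    simp
  induction C using Finset.strongInduction with
  | H C ih =>
    have h1 := key C
    rw [← Finset.insert_erase (Finset.mem_powerset_self C),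
      Finset.sum_insert (Finset.notMem_erase _ _),
      Finset.insert_erase (Finset.mem_powerset_self C)] at h1
    have h2 : C.powerset.filter (fun A => A ∪ C = C) = C.powerset :=
      Finset.filter_true_of_mem fun A hA => Finset.union_eq_right.mpr (Finset.mem_powerset.mp hA)
    rw [h2, ← Finset.sum_mul, ← hv] at h1
    have h3 : w' C = (v C)⁻¹ * ((if C = ∅ then 1 else 0) - ∑ A' ∈ C.ssubsets,
        ∑ A ∈ C.powerset.filter (fun A => A ∪ A' = C), w A * w' A') := by
      rw [← h1]
      change _ = (v C)⁻¹ * (v C * w' C + _ - _)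
      rw [add_sub_assoc]
      have := h0 C
      field_simp
      change _ = _ + (∑ A' ∈ C.ssubsets, _ - _)
      ring
    rw [h3]
    refine (hinv C).mul_left (IsOAlpha.sub ?_ ?_)
    · split_ifs with hC
      · simpa [hC] using isOAlpha_one
      · exact isOAlpha_zero _
    · refine isOAlpha_sum _ _ fun A' hA' => isOAlpha_sum _ _ fun A hA => ?_
      refine ((hw A).mul (ih A' (Finset.mem_ssubsets.mp hA'))).mono ?_
      rw [← (Finset.mem_filter.mp hA).2]
      exact_mod_cast Finset.card_union_le A A'

/-- Adjoining a point a to A applies `pointed a` to F * u, which gives (pointed a F + F * pointed a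
κ) * u. A convolution with κ costs one power of α, since κ(D) has order |D| - 1, and so each point
of A costs at most one. -/
theorem exists_conv_eq_of_cumulant_small {u : Finset ι → QAlpha} (hu : u ∅ = 1) {B0 : Finset ι}
    (hk : ∀ D ⊆ B0, D.Nonempty → IsOAlpha ((D.card : ℤ) - 1) (cumulant u D)) (A : Finset ι) :
    ∃ F : Finset ι → QAlpha, (∀ C ⊆ B0, IsOAlpha ((C.card : ℤ) - A.card) (F C)) ∧
      (fun B => if A ⊆ B then u B else 0) = conv F u := by
  induction A using Finset.induction_on with
  | empty =>
    refine ⟨fun C => if C = ∅ then 1 else 0, fun C _ => ?_, ?_⟩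
    · dsimp only
      split_ifs with h
      · simpa [h] using isOAlpha_one
      · exact isOAlpha_zero _
    · funext B
      simp [conv]
  | insert a A ha ih =>
    obtain ⟨F, hF, hFu⟩ := ih
    have hcard : ((insert a A).card : ℤ) = A.card + 1 := by
      rw [Finset.card_insert_of_notMem ha]; push_cast; rfl
    refine ⟨pointed a F + conv F (pointed a (cumulant u)), fun C hC => ?_, ?_⟩
    · refine IsOAlpha.add ?_ (isOAlpha_sum _ _ fun D hD => ?_)
      · unfold pointed
        split_ifs
        · exact (hF C hC).mono (by omega)
        · exact isOAlpha_zero _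
      · rw [Finset.mem_powerset] at hD
        unfold pointed
        split_ifs with haD
        · refine ((hF D (hD.trans hC)).mul
            (hk (C \ D) (Finset.sdiff_subset.trans hC) ⟨a, haD⟩)).mono ?_
          have := Finset.card_sdiff_add_card_eq_card hD
          omega
        · rw [mul_zero]; exact isOAlpha_zero _
    · rw [add_conv, conv_assoc, conv_pointed_cumulant_eq_pointed hu, ← pointed_conv, ← hFu]
      funext B
      simp only [pointed, Finset.insert_subset_iff]
      split_ifs <;> simp_all

/-- With w the differences of v h, one has u(B ∪ {h}) = ∑ w(A) [A ⊆ B] u(B) = ∑ w(A) (F_A * u)(B),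
while the recursion gives u(B ∪ {h}) = (κ(· ∪ {h}) * u)(B). Cancelling u yields κ(C ∪ {h}) = ∑ w(A)
F_A(C), of order |A| + (|C| - |A|) = |C|. -/
theorem isOAlpha_cumulant_of_ratio {u : Finset ι → QAlpha} (hu : u ∅ = 1)
    (v : ι → Finset ι → QAlpha) (hv : ∀ h, HasSmallDifferences (v h))
    (huv : ∀ h B, h ∉ B → u (insert h B) = v h B * u B) {H : Finset ι} (hH : H.Nonempty) :
    IsOAlpha ((H.card : ℤ) - 1) (cumulant u H) := by
  induction H using Finset.strongInduction with
  | H H ih =>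
    obtain ⟨h, hh⟩ := hH
    set B0 := H.erase h with hB0
    have hhB0 : h ∉ B0 := Finset.notMem_erase _ _
    have hins : insert h B0 = H := Finset.insert_erase hh
    obtain ⟨w, hw, hvw⟩ := hv h
    choose F hF hFu using exists_conv_eq_of_cumulant_small hu (B0 := B0) fun D hD hDn =>
      ih D (lt_of_le_of_lt hD (Finset.erase_ssubset hh)) hDn
    have key : ∀ B ⊆ B0, conv (fun C => cumulant u (insert h C)) u B =
        conv (fun C => ∑ A ∈ B0.powerset, w A * F A C) u B := by
      intro B hB
      have hhB : h ∉ B := fun hx => hhB0 (hB hx)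
      have h1 : conv (fun C => cumulant u (insert h C)) u B = u (insert h B) := by
        have h0 : ∑ A ∈ B.powerset, pointed h (cumulant u) A * u (insert h B \ A) = 0 := by
          refine Finset.sum_eq_zero fun A hA => ?_
          rw [pointed, if_neg fun hx => hhB (Finset.mem_powerset.mp hA hx), zero_mul]
        rw [← conv_pointed_cumulant hu (Finset.mem_insert_self h B), conv, conv,
          Finset.sum_powerset_insert hhB, h0, zero_add]
        · refine Finset.sum_congr rfl fun A hA => ?_
          rw [pointed, if_pos (Finset.mem_insert_self _ _), Finset.insert_sdiff_insert,
            Finset.sdiff_insert_of_notMem hhB]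
      have h2 : conv (fun C => ∑ A ∈ B0.powerset, w A * F A C) u B =
          ∑ A ∈ B0.powerset, w A * conv (F A) u B := by
        simp only [conv, Finset.sum_mul, Finset.mul_sum]
        rw [Finset.sum_comm]
        simp only [mul_assoc]
      rw [h1, h2, huv h B hhB, hvw, Finset.sum_mul]
      simp only [← hFu, mul_ite, mul_zero]
      rw [← Finset.sum_filter]
      refine Finset.sum_congr ?_ fun _ _ => rfl
      ext A
      simp only [Finset.mem_powerset, Finset.mem_filter]
      exact ⟨fun hA => ⟨hA.trans hB, hA⟩, fun hA => hA.2⟩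
    have h3 := conv_right_cancel hu key B0 subset_rfl
    rw [hins] at h3
    rw [h3]
    refine isOAlpha_sum _ _ fun A _ => ((hw A).mul (hF A B0 subset_rfl)).mono ?_
    rw [← hins, Finset.card_insert_of_notMem hhB0]
    push_cast
    omega

end Smallness

/-! ### Cumulants of hook polynomials. -/

section Hook

theorem rowLen_eq_zero_iff {lam : YoungDiagram} {k : ℕ} :
    lam.rowLen k = 0 ↔ lam.colLen 0 ≤ k := by
  have h1 : (k, 0) ∈ lam ↔ 0 < lam.rowLen k := YoungDiagram.mem_iff_lt_rowLen
  have h2 : (k, 0) ∈ lam ↔ k < lam.colLen 0 := YoungDiagram.mem_iff_lt_colLen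
  rw [h1] at h2
  omega

theorem prod_cells {M : Type*} [CommMonoid M] {lam : YoungDiagram} {N : ℕ}
    (hN : lam.colLen 0 ≤ N) (f : ℕ × ℕ → M) :
    ∏ c ∈ lam.cells, f c = ∏ k ∈ Finset.range N, ∏ c ∈ Finset.range (lam.rowLen k), f (k, c) := by
  rw [Finset.prod_sigma']
  refine Finset.prod_nbij' (fun c => ⟨c.1, c.2⟩) (fun x => (x.1, x.2)) ?_ ?_ ?_ ?_ ?_
  · rintro ⟨i, j⟩ h
    have h1 : (i, j) ∈ lam := h
    have h2 : (i, 0) ∈ lam := lam.up_left_mem le_rfl (Nat.zero_le _) h1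
    simp only [Finset.mem_sigma, Finset.mem_range]
    exact ⟨(YoungDiagram.mem_iff_lt_colLen.mp h2).trans_le hN,
      YoungDiagram.mem_iff_lt_rowLen.mp h1⟩
  · rintro ⟨i, j⟩ h
    simp only [Finset.mem_sigma, Finset.mem_range] at h
    exact (YoungDiagram.mem_cells _).mpr (YoungDiagram.mem_iff_lt_rowLen.mpr h.2)
  · intro _ _; rfl
  · intro _ _; rfl
  · intro _ _; rfl

theorem prod_Ico_antitone {M : Type*} [CommMonoid M] {a : ℕ → ℕ} (ha : Antitone a) (f : ℕ → M)
    {k N : ℕ} (h : k ≤ N) : ∏ c ∈ Finset.Ico (a N) (a k), f c =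
      ∏ i ∈ Finset.Ico k N, ∏ c ∈ Finset.Ico (a (i + 1)) (a i), f c := by
  induction N, h using Nat.le_induction with
  | base => simp
  | succ N hkN ih =>
    rw [Finset.prod_Ico_succ_top hkN, ← ih, mul_comm,
      Finset.prod_Ico_consecutive _ (ha (Nat.le_succ N)) (ha hkN)]

/-- The product `∏_{s < m} (c + α (n + s))`. -/
def risingProduct (c n m : ℕ) : QAlpha :=
  ∏ s ∈ Finset.range m, ((c : QAlpha) + alpha * ((n + s : ℕ) : QAlpha))

theorem risingProduct_add (c n a b : ℕ) :
    risingProduct c n (a + b) = risingProduct c n a * risingProduct c (n + a) b := by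
  simp only [risingProduct, Finset.prod_range_add, add_assoc]

theorem linear_ne_zero {c : ℕ} (hc : c ≠ 0) (n : ℕ) : (c : QAlpha) + alpha * (n : QAlpha) ≠ 0 := by
  simpa using algebraMap_add_alpha_mul_ne_zero (a := (c : ℚ)) (n : ℚ) (by exact_mod_cast hc)

theorem isOAlpha_linear_inv {c : ℕ} (hc : c ≠ 0) (n : ℕ) :
    IsOAlpha 0 ((c : QAlpha) + alpha * (n : QAlpha))⁻¹ := by
  simpa using isOAlpha_inv_linear (a := (c : ℚ)) (n : ℚ) (by exact_mod_cast hc)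

theorem risingProduct_ne_zero {c : ℕ} (hc : c ≠ 0) (n m : ℕ) : risingProduct c n m ≠ 0 :=
  Finset.prod_ne_zero_iff.mpr fun _ _ => linear_ne_zero hc _

theorem isOAlpha_risingProduct_inv {c : ℕ} (hc : c ≠ 0) (n m : ℕ) :
    IsOAlpha 0 (risingProduct c n m)⁻¹ := by
  rw [risingProduct, ← Finset.prod_inv_distrib]
  exact isOAlpha_prod _ _ fun _ _ => isOAlpha_linear_inv hc _

/-- The product of length n' + m + m' starting at n is split in two ways. With n, m coming from B
and n', m' from a new index h, the last factor is the old one, and the two others have lengths that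
depend only on m' and n'. -/
theorem risingProduct_add_add {c : ℕ} (hc : c ≠ 0) (n n' m m' : ℕ) :
    risingProduct c (n + n') (m + m') =
      risingProduct c (n + m) (n' + m') * (risingProduct c n n')⁻¹ * risingProduct c n m := by
  have h : risingProduct c n n' * risingProduct c (n + n') (m + m') =
      risingProduct c n m * risingProduct c (n + m) (n' + m') := by
    rw [← risingProduct_add, ← risingProduct_add]
    congr 1
    omega
  have h0 := risingProduct_ne_zero hc n n'
  field_simp
  linear_combination h

theorem hasSmallDifferences_risingProduct {ι : Type*} [DecidableEq ι] (c m : ℕ) (n : ι → ℕ) :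
    HasSmallDifferences fun B : Finset ι => risingProduct c (∑ i ∈ B, n i) m := by
  refine HasSmallDifferences.prod _ _ fun s _ => ?_
  have h1 := (hasSmallDifferences_const (ι := ι) (isOAlpha_natCast c)).add
    ((hasSmallDifferences_sum n).add (hasSmallDifferences_const (ι := ι)
      ((isOAlpha_alpha.mono zero_le_one).mul_left (isOAlpha_natCast s))))
  convert h1 using 3 with B
  push_cast
  ring

/-- In row k, the columns of length i + 1 are those from λ_{i+1} up to λ_i; their boxes have leg i -
k, and their arms run through λ_k - λ_i + s. -/
theorem hook_eq {lam : YoungDiagram} {N : ℕ} (hN : lam.colLen 0 ≤ N) :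
    hook lam = ∏ k ∈ Finset.range N, ∏ i ∈ Finset.Ico k N,
      risingProduct (i - k + 1) (lam.rowLen k - lam.rowLen i)
        (lam.rowLen i - lam.rowLen (i + 1)) := by
  rw [hook, prod_cells hN]
  refine Finset.prod_congr rfl fun k hk => ?_
  rw [Finset.mem_range] at hk
  have hanti : Antitone lam.rowLen := fun i j h => lam.rowLen_anti i j h
  rw [Finset.range_eq_Ico, ← rowLen_eq_zero_iff.mpr hN, prod_Ico_antitone hanti _ hk.le]
  refine Finset.prod_congr rfl fun i hi => ?_
  rw [Finset.mem_Ico] at hi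
  have hi1 := hanti (Nat.le_succ i)
  have hki := hanti hi.1
  -- The order is reversed because the arm decreases as the column index grows.
  rw [risingProduct, Finset.prod_Ico_eq_prod_range, ← Finset.prod_range_reflect]
  refine Finset.prod_congr rfl fun s hs => ?_
  rw [Finset.mem_range] at hs
  simp only [Nat.succ_eq_add_one] at hi1
  set c := lam.rowLen (i + 1) + (lam.rowLen i - lam.rowLen (i + 1) - 1 - s) with hc
  have h1 : i < lam.colLen c := YoungDiagram.mem_iff_lt_colLen.mp
    (YoungDiagram.mem_iff_lt_rowLen.mpr (by omega))
  have h2 : ¬ i + 1 < lam.colLen c := fun h => by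
    have := YoungDiagram.mem_iff_lt_rowLen.mp (YoungDiagram.mem_iff_lt_colLen.mpr h)
    omega
  have h3 : lam.colLen c - (k + 1) = i - k := by omega
  have h4 : lam.rowLen k - (c + 1) = lam.rowLen k - lam.rowLen i + s := by omega
  rw [h3, h4]
  push_cast
  ring

theorem colLen_entrywiseSum_le {ι : Type*} {lam : ι → YoungDiagram} {N : ℕ} {B : Finset ι}
    (hN : ∀ i ∈ B, (lam i).colLen 0 ≤ N) : (entrywiseSum lam B).colLen 0 ≤ N := by
  rw [← rowLen_eq_zero_iff, rowLen_entrywiseSum]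
  exact Finset.sum_eq_zero fun i hi => rowLen_eq_zero_iff.mpr (hN i hi)

theorem entrywiseSum_empty {ι : Type*} (lam : ι → YoungDiagram) : entrywiseSum lam ∅ = ⊥ := by
  ext c
  simp [entrywiseSum]

theorem hook_bot : hook ⊥ = 1 := by
  simp [hook]

/-- The cumulants of hook polynomials of `r` partitions are `O(α^{r-1})`. -/
theorem isOAlpha_cumulant_hook {ι : Type*} [DecidableEq ι] {lam : ι → YoungDiagram} {N : ℕ}
    (hN : ∀ i, (lam i).colLen 0 ≤ N) {H : Finset ι} (hH : H.Nonempty) :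
    IsOAlpha ((H.card : ℤ) - 1) (cumulant (fun B => hook (entrywiseSum lam B)) H) := by
  have hanti : ∀ i, Antitone (lam i).rowLen := fun i a b h => (lam i).rowLen_anti a b h
  have hook_sum : ∀ B, hook (entrywiseSum lam B) =
      ∏ k ∈ Finset.range N, ∏ i ∈ Finset.Ico k N, risingProduct (i - k + 1)
        (∑ j ∈ B, ((lam j).rowLen k - (lam j).rowLen i))
        (∑ j ∈ B, ((lam j).rowLen i - (lam j).rowLen (i + 1))) := by
    intro B
    rw [hook_eq (colLen_entrywiseSum_le fun i _ => hN i)]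
    refine Finset.prod_congr rfl fun k _ => Finset.prod_congr rfl fun i hi => ?_
    rw [Finset.mem_Ico] at hi
    simp only [rowLen_entrywiseSum]
    rw [Finset.sum_tsub_distrib _ fun j _ => hanti j hi.1,
      Finset.sum_tsub_distrib _ fun j _ => hanti j (Nat.le_succ i)]
  -- The ratio comes from `risingProduct_add_add`. The lengths of its products depend only on h, and
  -- their starting points are additive in B, so its differences are small.
  refine isOAlpha_cumulant_of_ratio (u := fun B => hook (entrywiseSum lam B))
    (by rw [entrywiseSum_empty, hook_bot])
    (fun h B => ∏ k ∈ Finset.range N, ∏ i ∈ Finset.Ico k N,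
      (risingProduct (i - k + 1)
        (∑ j ∈ B, (((lam j).rowLen k - (lam j).rowLen i) +
          ((lam j).rowLen i - (lam j).rowLen (i + 1))))
        (((lam h).rowLen k - (lam h).rowLen i) +
          ((lam h).rowLen i - (lam h).rowLen (i + 1))) *
      (risingProduct (i - k + 1) (∑ j ∈ B, ((lam j).rowLen k - (lam j).rowLen i))
        ((lam h).rowLen k - (lam h).rowLen i))⁻¹)) ?_ ?_ hH
  · intro h
    refine HasSmallDifferences.prod _ _ fun k _ => HasSmallDifferences.prod _ _ fun i _ => ?_
    exact (hasSmallDifferences_risingProduct _ _ _).mul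
      ((hasSmallDifferences_risingProduct _ _ _).inv
        (fun B => risingProduct_ne_zero (Nat.succ_ne_zero _) _ _)
        (fun B => isOAlpha_risingProduct_inv (Nat.succ_ne_zero _) _ _))
  · intro h B hB
    simp only [hook_sum, ← Finset.prod_mul_distrib, Finset.sum_insert hB]
    refine Finset.prod_congr rfl fun k _ => Finset.prod_congr rfl fun i _ => ?_
    rw [Finset.sum_add_distrib, ← risingProduct_add_add (Nat.succ_ne_zero _)]
    congr 1 <;> exact add_comm _ _

end Hook

/-! ### Exponent vectors, dominance and the strict order behind triangularity. -/

section Exponents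

variable {N : ℕ}

theorem sum_eq_add_add_sum_compl {M : Type*} [AddCommMonoid M] {i j : Fin N} (h : i ≠ j)
    (g : Fin N → M) : ∑ k, g k = g i + g j + ∑ k ∈ {i, j}ᶜ, g k := by
  rw [← Finset.sum_add_sum_compl {i, j}, Finset.sum_pair h]

/-- The sum of the maxima of all ordered pairs of entries. -/
def maxSum (d : Fin N → ℕ) : ℕ := ∑ i, ∑ j, max (d i) (d j)

theorem maxSum_comp_perm (d : Fin N → ℕ) (e : Equiv.Perm (Fin N)) :
    maxSum (d ∘ e) = maxSum d := by
  unfold maxSum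
  rw [← Equiv.sum_comp e (fun i => ∑ j, max (d i) (d j))]
  exact Finset.sum_congr rfl fun i _ => Equiv.sum_comp e fun j => max (d (e i)) (d j)

/-- For a sorted vector the larger entry of a pair is the one with the smaller index. So `maxSum` is
expressed by partial sums, which makes it monotone for dominance. -/
theorem maxSum_add_sum_of_antitone {d : Fin N → ℕ} (hd : Antitone d) :
    maxSum d + ∑ i, d i = 2 * ∑ j, ∑ i ∈ Finset.Iic j, d i := by
  have h1 : ∀ i j : Fin N, max (d i) (d j) + (if i = j then d i else 0) =
      (if i ≤ j then d i else 0) + (if j ≤ i then d j else 0) := by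
    intro i j
    rcases lt_trichotomy i j with h | h | h
    · simp [h.ne, h.le, h.not_ge, hd h.le]
    · simp [h]
    · simp [h.ne', h.le, h.not_ge, hd h.le]
  have h2 : ∑ i, d i = ∑ i, ∑ j, if i = j then d i else 0 := by simp
  rw [h2, maxSum, ← Finset.sum_add_distrib]
  simp only [← Finset.sum_add_distrib, h1]
  simp only [Finset.sum_add_distrib]
  rw [Finset.sum_comm, ← two_mul]
  congr 1
  refine Finset.sum_congr rfl fun j _ => ?_
  rw [← Finset.sum_filter]
  congr 1
  ext i
  simp

theorem exists_perm_antitone (d : Fin N → ℕ) : ∃ e : Equiv.Perm (Fin N), Antitone (d ∘ e) :=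
  ⟨Tuple.sort (fun i => OrderDual.toDual (d i)), fun _ _ h =>
    Tuple.monotone_sort (fun i => OrderDual.toDual (d i)) h⟩

/-- The exponent vector of a partition. -/
def rowVec (N : ℕ) (lam : YoungDiagram) (i : Fin N) : ℕ := lam.rowLen i

theorem rowVec_antitone (lam : YoungDiagram) : Antitone (rowVec N lam) :=
  fun i j h => lam.rowLen_anti i j h

theorem sum_range_rowLen {lam : YoungDiagram} (hN : lam.colLen 0 ≤ N) :
    ∑ k ∈ Finset.range N, lam.rowLen k = lam.card := by
  have := Multiplicative.toAdd.congr_arg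
    (prod_cells hN (fun _ => Multiplicative.ofAdd 1))
  simp only [toAdd_prod, toAdd_ofAdd, Finset.sum_const, Finset.card_range, smul_eq_mul,
    mul_one] at this
  exact this.symm

theorem sum_rowVec {lam : YoungDiagram} (hN : lam.colLen 0 ≤ N) :
    ∑ i, rowVec N lam i = lam.card := by
  rw [← sum_range_rowLen hN]
  exact Fin.sum_univ_eq_sum_range (fun k => lam.rowLen k) N

theorem sum_Iic_rowVec (lam : YoungDiagram) (j : Fin N) :
    ∑ i ∈ Finset.Iic j, rowVec N lam i = ∑ k ∈ Finset.range (j + 1), lam.rowLen k := by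
  refine Finset.sum_nbij (fun i => (i : ℕ)) ?_ ?_ ?_ ?_
  · intro i hi
    have : i ≤ j := Finset.mem_Iic.mp hi
    simp only [Finset.mem_range]
    omega
  · exact fun _ _ _ _ h => Fin.ext h
  · intro k hk
    have hk : k < j + 1 := by simpa using hk
    exact ⟨⟨k, by omega⟩, by simpa [Fin.le_def] using Nat.lt_succ_iff.mp hk, rfl⟩
  · intro _ _; rfl

theorem sum_le_sum_range_of_antitone {a : ℕ → ℕ} (ha : Antitone a) (T : Finset ℕ) :
    ∑ i ∈ T, a i ≤ ∑ k ∈ Finset.range T.card, a k := by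
  induction T using Finset.induction_on_max with
  | empty => simp
  | insert m S hm ih =>
    have hmS : m ∉ S := fun h => lt_irrefl _ (hm m h)
    rw [Finset.sum_insert hmS, Finset.card_insert_of_notMem hmS, Finset.sum_range_succ, add_comm]
    refine add_le_add ih (ha ?_)
    calc S.card ≤ (Finset.range m).card :=
          Finset.card_le_card fun x hx => Finset.mem_range.mpr (hm x hx)
      _ = m := Finset.card_range m

/-- The exponent vectors of monomials occurring in symmetric polynomials dominated by `lam`. -/
def DominatedBy (lam : YoungDiagram) (d : Fin N → ℕ) : Prop :=
  ∑ i, d i = lam.card ∧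
    ∀ S : Finset (Fin N), ∑ i ∈ S, d i ≤ ∑ k ∈ Finset.range S.card, lam.rowLen k

theorem DominatedBy.comp_perm {lam : YoungDiagram} {d : Fin N → ℕ} (h : DominatedBy lam d)
    (e : Equiv.Perm (Fin N)) : DominatedBy lam (d ∘ e) := by
  refine ⟨(Equiv.sum_comp e d).trans h.1, fun S => ?_⟩
  have := h.2 (S.map e.toEmbedding)
  rwa [Finset.sum_map, Finset.card_map] at this

theorem dominatedBy_of_rowLen {nu lam : YoungDiagram} (hN : nu.colLen 0 ≤ N)
    (hcard : nu.card = lam.card)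
    (h : ∀ j : ℕ, ∑ i ∈ Finset.range j, nu.rowLen i ≤ ∑ i ∈ Finset.range j, lam.rowLen i) :
    DominatedBy lam (rowVec N nu) := by
  refine ⟨(sum_rowVec hN).trans hcard, fun S => ?_⟩
  refine le_trans ?_ (h S.card)
  have := sum_le_sum_range_of_antitone (a := nu.rowLen) (fun i j h => nu.rowLen_anti i j h)
    (S.map Fin.valEmbedding)
  rwa [Finset.sum_map, Finset.card_map] at this

theorem dominatedBy_self {lam : YoungDiagram} (hN : lam.colLen 0 ≤ N) :
    DominatedBy lam (rowVec N lam) :=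
  dominatedBy_of_rowLen hN rfl fun _ => le_rfl

theorem sum_Iic_eq_of_forall {a b : Fin N → ℕ}
    (h : ∀ j, ∑ i ∈ Finset.Iic j, a i = ∑ i ∈ Finset.Iic j, b i) : a = b := by
  funext j
  induction j using WellFoundedLT.induction with
  | ind j ih =>
    have := h j
    rw [← Finset.Iio_insert, Finset.sum_insert (by simp), Finset.sum_insert (by simp),
      Finset.sum_congr rfl fun i hi => ih i (Finset.mem_Iio.mp hi)] at this
    exact add_right_cancel this

theorem DominatedBy.sum_Iic_le {lam : YoungDiagram} {d : Fin N → ℕ} (h : DominatedBy lam d)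
    (j : Fin N) : ∑ i ∈ Finset.Iic j, d i ≤ ∑ i ∈ Finset.Iic j, rowVec N lam i := by
  rw [sum_Iic_rowVec]
  simpa using h.2 (Finset.Iic j)

theorem DominatedBy.maxSum_le {lam : YoungDiagram} (hN : lam.colLen 0 ≤ N) {d : Fin N → ℕ}
    (h : DominatedBy lam d) : maxSum d ≤ maxSum (rowVec N lam) := by
  obtain ⟨e, he⟩ := exists_perm_antitone d
  have h' := h.comp_perm e
  rw [← maxSum_comp_perm d e]
  have h1 := maxSum_add_sum_of_antitone he
  have h2 := maxSum_add_sum_of_antitone (rowVec_antitone (N := N) lam)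
  rw [h'.1] at h1
  rw [sum_rowVec hN] at h2
  have := Finset.sum_le_sum fun j (_ : j ∈ Finset.univ) => h'.sum_Iic_le j
  omega

/-- After sorting, every partial sum of d is at most that of λ; equality of their totals forces
equality of each. -/
theorem DominatedBy.exists_perm {lam : YoungDiagram} (hN : lam.colLen 0 ≤ N) {d : Fin N → ℕ}
    (h : DominatedBy lam d) (hd : maxSum (rowVec N lam) ≤ maxSum d) :
    ∃ e : Equiv.Perm (Fin N), d ∘ e = rowVec N lam := by
  obtain ⟨e, he⟩ := exists_perm_antitone d
  refine ⟨e, ?_⟩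
  have h' := h.comp_perm e
  rw [← maxSum_comp_perm d e] at hd
  have h1 := maxSum_add_sum_of_antitone he
  have h2 := maxSum_add_sum_of_antitone (rowVec_antitone (N := N) lam)
  rw [h'.1] at h1
  rw [sum_rowVec hN] at h2
  have h3 := fun j (_ : j ∈ Finset.univ) => h'.sum_Iic_le j
  have h4 : ∑ j, ∑ i ∈ Finset.Iic j, (d ∘ e) i = ∑ j, ∑ i ∈ Finset.Iic j, rowVec N lam i :=
    le_antisymm (Finset.sum_le_sum h3) (by omega)
  rw [Finset.sum_eq_sum_iff_of_le h3] at h4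
  exact sum_Iic_eq_of_forall fun j => h4 j (Finset.mem_univ j)

/-- The exponent vector with `i`-th entry `a` and the same sum of the entries `i` and `j`. -/
def spread (d : Fin N → ℕ) (i j : Fin N) (a : ℕ) : Fin N → ℕ :=
  Function.update (Function.update d i a) j (d i + d j - a)

theorem spread_left (d : Fin N → ℕ) {i j : Fin N} (h : i ≠ j) (a : ℕ) : spread d i j a i = a := by
  simp [spread, h]

theorem spread_right (d : Fin N → ℕ) (i j : Fin N) (a : ℕ) :
    spread d i j a j = d i + d j - a := by
  simp [spread]

theorem spread_of_ne (d : Fin N → ℕ) {i j k : Fin N} (hi : k ≠ i) (hj : k ≠ j) (a : ℕ) :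
    spread d i j a k = d k := by
  simp [spread, hi, hj]

theorem sum_spread_of_notMem (d : Fin N → ℕ) {i j : Fin N} (a : ℕ) {S : Finset (Fin N)}
    (hi : i ∉ S) (hj : j ∉ S) : ∑ k ∈ S, spread d i j a k = ∑ k ∈ S, d k :=
  Finset.sum_congr rfl fun _ hk =>
    spread_of_ne d (ne_of_mem_of_not_mem hk hi) (ne_of_mem_of_not_mem hk hj) a

/-- The maximum of the two moved entries increases strictly, and the sum of their maxima with any
third entry does not decrease, by convexity. -/
theorem maxSum_lt_maxSum_spread (d : Fin N → ℕ) {i j : Fin N} (h : i ≠ j) {a : ℕ}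
    (ha : a < min (d i) (d j)) : maxSum d < maxSum (spread d i j a) := by
  have hs : ∀ k ∈ ({i, j}ᶜ : Finset (Fin N)), spread d i j a k = d k := by
    intro k hk
    simp only [Finset.mem_compl, Finset.mem_insert, Finset.mem_singleton, not_or] at hk
    exact spread_of_ne d hk.1 hk.2 a
  have hexp : ∀ e : Fin N → ℕ, maxSum e = e i + e j + 2 * max (e i) (e j) +
      2 * ∑ k ∈ {i, j}ᶜ, (max (e i) (e k) + max (e j) (e k)) +
      ∑ k ∈ {i, j}ᶜ, ∑ l ∈ {i, j}ᶜ, max (e k) (e l) := by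
    intro e
    have hc := fun k => sum_eq_add_add_sum_compl h fun l => max (e k) (e l)
    have hc' : ∀ k, ∑ l, max (e k) (e l) =
        max (e i) (e k) + max (e j) (e k) + ∑ l ∈ {i, j}ᶜ, max (e k) (e l) := fun k => by
      rw [hc, max_comm (e k) (e i), max_comm (e k) (e j)]
    rw [maxSum, sum_eq_add_add_sum_compl h, hc i, hc j, Finset.sum_congr rfl fun k _ => hc' k,
      max_comm (e j) (e i)]
    simp only [Finset.sum_add_distrib, max_self]
    ring
  rw [hexp, hexp (spread d i j a), spread_left d h, spread_right]
  have e1 : ∑ k ∈ {i, j}ᶜ, ∑ l ∈ {i, j}ᶜ, max (spread d i j a k) (spread d i j a l) =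
      ∑ k ∈ {i, j}ᶜ, ∑ l ∈ {i, j}ᶜ, max (d k) (d l) :=
    Finset.sum_congr rfl fun k hk => Finset.sum_congr rfl fun l hl => by rw [hs k hk, hs l hl]
  have e2 : ∑ k ∈ {i, j}ᶜ, (max (d i) (d k) + max (d j) (d k)) ≤
      ∑ k ∈ {i, j}ᶜ, (max a (spread d i j a k) + max (d i + d j - a) (spread d i j a k)) := by
    refine Finset.sum_le_sum fun k hk => ?_
    rw [hs k hk]
    omega
  rw [e1]
  omega

theorem DominatedBy.of_spread {lam : YoungDiagram} {d : Fin N → ℕ} {i j : Fin N} (h : i ≠ j)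
    {a : ℕ} (ha : a < min (d i) (d j)) (hd : DominatedBy lam (spread d i j a)) :
    DominatedBy lam d := by
  refine ⟨?_, fun S => ?_⟩
  · rw [← hd.1, sum_eq_add_add_sum_compl h, sum_eq_add_add_sum_compl h, spread_left d h,
      spread_right, sum_spread_of_notMem d a (by simp) (by simp)]
    omega
  · by_cases hi : i ∈ S
    · by_cases hj : j ∈ S
      · refine le_trans (le_of_eq ?_) (hd.2 S)
        have hj' : j ∈ S.erase i := Finset.mem_erase.mpr ⟨h.symm, hj⟩
        rw [← Finset.add_sum_erase S _ hi, ← Finset.add_sum_erase _ _ hj',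
          ← Finset.add_sum_erase S _ hi, ← Finset.add_sum_erase _ _ hj', spread_left d h,
          spread_right, sum_spread_of_notMem d a (by simp) (by simp)]
        omega
      · have hj' : j ∉ S.erase i := fun hh => hj (Finset.mem_of_mem_erase hh)
        -- The larger entry of the spread vector sits at j, so the bound for S is read off from S
        -- with i replaced by j.
        have := hd.2 (insert j (S.erase i))
        rw [Finset.sum_insert hj', Finset.card_insert_of_notMem hj',
          Finset.card_erase_add_one hi, spread_right,
          sum_spread_of_notMem d a (by simp) hj'] at this
        rw [← Finset.add_sum_erase S _ hi]
        omega
    · by_cases hj : j ∈ S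
      · have := hd.2 S
        rw [← Finset.add_sum_erase S _ hj, spread_right,
          sum_spread_of_notMem d a (fun hh => hi (Finset.mem_of_mem_erase hh)) (by simp)] at this
        rw [← Finset.add_sum_erase S _ hj]
        omega
      · rw [← sum_spread_of_notMem d a hi hj]
        exact hd.2 S

end Exponents

/-! ### The Laplace–Beltrami operator on coefficients. -/

section Operator

variable {N : ℕ}

/-- The coefficient of the monomial with exponent vector `d`. -/
def coeffAt (d : Fin N → ℕ) : MvPolynomial (Fin N) QAlpha →ₗ[QAlpha] QAlpha :=
  MvPolynomial.lcoeff QAlpha (Finsupp.equivFunOnFinite.symm d)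

theorem coeffAt_apply (d : Fin N → ℕ) (P : MvPolynomial (Fin N) QAlpha) :
    coeffAt d P = MvPolynomial.coeff (Finsupp.equivFunOnFinite.symm d) P := rfl

theorem coeff_eq_coeffAt (m : Fin N →₀ ℕ) (P : MvPolynomial (Fin N) QAlpha) :
    MvPolynomial.coeff m P = coeffAt m P := by
  rw [coeffAt_apply, Finsupp.equivFunOnFinite_symm_coe]

theorem ext_coeffAt {P Q : MvPolynomial (Fin N) QAlpha}
    (h : ∀ d : Fin N → ℕ, coeffAt d P = coeffAt d Q) : P = Q :=
  MvPolynomial.ext _ _ fun m => by rw [coeff_eq_coeffAt, coeff_eq_coeffAt, h]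

theorem coeffAt_monomial (d : Fin N → ℕ) (m : Fin N →₀ ℕ) (c : QAlpha) :
    coeffAt d (MvPolynomial.monomial m c) = if (m : Fin N → ℕ) = d then c else 0 := by
  rw [coeffAt_apply, MvPolynomial.coeff_monomial]
  refine if_congr ⟨fun h => ?_, fun h => ?_⟩ rfl rfl
  · rw [h]; rfl
  · rw [← h, Finsupp.equivFunOnFinite_symm_coe]

theorem coeffAt_C_mul (d : Fin N → ℕ) (c : QAlpha) (P : MvPolynomial (Fin N) QAlpha) :
    coeffAt d (MvPolynomial.C c * P) = c * coeffAt d P :=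
  MvPolynomial.coeff_C_mul _ _ _

theorem coeffAt_mul_ne_zero {d : Fin N → ℕ} {P Q : MvPolynomial (Fin N) QAlpha}
    (h : coeffAt d (P * Q) ≠ 0) :
    ∃ a b : Fin N → ℕ, a + b = d ∧ coeffAt a P ≠ 0 ∧ coeffAt b Q ≠ 0 := by
  rw [coeffAt_apply, MvPolynomial.coeff_mul] at h
  obtain ⟨⟨a, b⟩, hab, hne⟩ := Finset.exists_ne_zero_of_sum_ne_zero h
  rw [Finset.HasAntidiagonal.mem_antidiagonal] at hab
  refine ⟨a, b, ?_, ?_, ?_⟩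
  · rw [← Finsupp.coe_add, hab]; rfl
  · rw [← coeff_eq_coeffAt]; exact left_ne_zero_of_mul hne
  · rw [← coeff_eq_coeffAt]; exact right_ne_zero_of_mul hne

theorem coeffAt_mul_of_unique {a b : Fin N → ℕ} {P Q : MvPolynomial (Fin N) QAlpha}
    (h : ∀ a' b', a' + b' = a + b → coeffAt a' P ≠ 0 → coeffAt b' Q ≠ 0 → a' = a) :
    coeffAt (a + b) (P * Q) = coeffAt a P * coeffAt b Q := by
  rw [coeffAt_apply, MvPolynomial.coeff_mul,
    Finset.sum_eq_single (Finsupp.equivFunOnFinite.symm a, Finsupp.equivFunOnFinite.symm b)]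
  · rfl
  · rintro ⟨a', b'⟩ hab hne
    by_contra h0
    rw [Finset.HasAntidiagonal.mem_antidiagonal] at hab
    have hab' : (a' : Fin N → ℕ) + b' = a + b := by
      rw [← Finsupp.coe_add, hab]; rfl
    have h1 := h a' b' hab' (by rw [← coeff_eq_coeffAt]; exact left_ne_zero_of_mul h0)
      (by rw [← coeff_eq_coeffAt]; exact right_ne_zero_of_mul h0)
    have h2 : (b' : Fin N → ℕ) = b := by
      rw [h1] at hab'
      exact add_left_cancel hab'
    apply hne
    rw [Prod.mk.injEq]
    exact ⟨by rw [← h1, Finsupp.equivFunOnFinite_symm_coe],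
      by rw [← h2, Finsupp.equivFunOnFinite_symm_coe]⟩
  · intro hn
    refine absurd (Finset.HasAntidiagonal.mem_antidiagonal.mpr ?_) hn
    ext i
    rfl

theorem isSymmetric_iff {P : MvPolynomial (Fin N) QAlpha} :
    P.IsSymmetric ↔ ∀ (e : Equiv.Perm (Fin N)) (d : Fin N → ℕ),
      coeffAt (d ∘ e) P = coeffAt d P := by
  have key : ∀ (e : Equiv.Perm (Fin N)) (d : Fin N → ℕ),
      coeffAt d (MvPolynomial.rename e P) = coeffAt (d ∘ e) P := by
    intro e d
    rw [coeffAt_apply, coeffAt_apply, 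
      ← MvPolynomial.coeff_rename_mapDomain e e.injective P
        (Finsupp.equivFunOnFinite.symm (d ∘ e))]
    congr 1
    ext i
    obtain ⟨j, rfl⟩ := e.surjective i
    rw [Finsupp.mapDomain_apply e.injective]
    rfl
  constructor
  · intro h e d
    rw [← key, h e]
  · intro h e
    refine ext_coeffAt fun d => ?_
    rw [key, h]

theorem coeffAt_X_mul (d : Fin N → ℕ) (i : Fin N) (P : MvPolynomial (Fin N) QAlpha) :
    coeffAt d (MvPolynomial.X i * P) =
      if d i = 0 then 0 else coeffAt (Function.update d i (d i - 1)) P := by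
  rw [coeffAt_apply, MvPolynomial.coeff_X_mul', coeffAt_apply]
  by_cases h : d i = 0
  · rw [if_pos h, if_neg]
    simpa using h
  · rw [if_neg h, if_pos (by simpa using h)]
    congr 1
    ext j
    by_cases hj : j = i
    · subst hj
      simp
    · simp [hj]

theorem coeffAt_X_mul_pderiv (d : Fin N → ℕ) (i : Fin N) (P : MvPolynomial (Fin N) QAlpha) :
    coeffAt d (MvPolynomial.X i * MvPolynomial.pderiv i P) = (d i : QAlpha) * coeffAt d P := by
  induction P using MvPolynomial.induction_on' with
  | monomial m c =>
    rw [MvPolynomial.X_mul_pderiv_monomial, map_nsmul, coeffAt_monomial]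
    split_ifs with h
    · rw [h, nsmul_eq_mul]
    · simp
  | add p q hp hq =>
    rw [map_add, mul_add, map_add, hp, hq, map_add, mul_add]

theorem coeffAt_X_sq_mul_pderiv (d : Fin N → ℕ) (i : Fin N) (P : MvPolynomial (Fin N) QAlpha) :
    coeffAt d (MvPolynomial.X i ^ 2 * MvPolynomial.pderiv i P) =
      ((d i - 1 : ℕ) : QAlpha) * coeffAt (Function.update d i (d i - 1)) P := by
  rw [pow_two, mul_assoc, coeffAt_X_mul, coeffAt_X_mul_pderiv]
  split_ifs with h
  · simp [h]
  · simp

theorem coeffAt_D2 (d : Fin N → ℕ) (P : MvPolynomial (Fin N) QAlpha) :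
    coeffAt d (D2 N P) = ((∑ i, (d i).choose 2 : ℕ) : QAlpha) * coeffAt d P := by
  rw [D2, coeffAt_C_mul, map_sum, Nat.cast_sum, Finset.sum_mul, Finset.mul_sum]
  refine Finset.sum_congr rfl fun i _ => ?_
  have h : MvPolynomial.X i ^ 2 * MvPolynomial.pderiv i (MvPolynomial.pderiv i P) =
      MvPolynomial.X i * MvPolynomial.pderiv i (MvPolynomial.X i * MvPolynomial.pderiv i P) -
        MvPolynomial.X i * MvPolynomial.pderiv i P := by
    rw [MvPolynomial.pderiv_mul, MvPolynomial.pderiv_X_self]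
    ring
  rw [h, map_sub, coeffAt_X_mul_pderiv, coeffAt_X_mul_pderiv, Nat.cast_choose_two]
  ring

/-- The coefficients of the quotient of `x_i² ∂_i f - x_j² ∂_j f` by `x_i - x_j`, in terms of the
coefficients of a symmetric polynomial `f`. -/
def pairCoeff (f : (Fin N → ℕ) → QAlpha) (i j : Fin N) (d : Fin N → ℕ) : QAlpha :=
  (max (d i) (d j) : ℕ) * f d + ∑ a ∈ Finset.range (min (d i) (d j)),
    ((d i + d j - 2 * a : ℕ) : QAlpha) * f (spread d i j a)

/-- The two brackets are the coefficients of the quotient after lowering the exponent of x_i,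
respectively of x_j. Their sums differ by at most one summand, and the symmetry of F matches it with
the diagonal terms. -/
theorem pairCoeff_telescope {F : ℕ → QAlpha} (p q : ℕ)
    (hF : ∀ a b, a + b = p + q + 1 → F a = F b) :
    ((max p (q + 1) : ℕ) * F p + ∑ a ∈ Finset.range (min p (q + 1)),
        ((p + q + 1 - 2 * a : ℕ) : QAlpha) * F a) -
      ((max (p + 1) q : ℕ) * F (p + 1) + ∑ a ∈ Finset.range (min (p + 1) q),
        ((p + q + 1 - 2 * a : ℕ) : QAlpha) * F a) = p * F p - q * F (p + 1) := by
  rcases lt_trichotomy p q with h | rfl | h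
  · rw [max_eq_right (by omega), max_eq_right (by omega), min_eq_left (by omega),
      min_eq_left (by omega), Finset.sum_range_succ, Nat.cast_sub (by omega)]
    push_cast
    ring
  · rw [max_eq_right (by omega), max_eq_left (by omega), min_eq_left (by omega),
      min_eq_right (by omega), hF p (p + 1) (by omega)]
    ring
  · rw [max_eq_left (by omega), max_eq_left (by omega), min_eq_right (by omega),
      min_eq_right (by omega), Finset.sum_range_succ, Nat.cast_sub (by omega),
      hF q (p + 1) (by omega)]
    push_cast
    ring

theorem sub_mul_eq_of_pairCoeff {P G : MvPolynomial (Fin N) QAlpha} (hP : P.IsSymmetric)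
    {i j : Fin N} (hij : i ≠ j)
    (hG : ∀ d, coeffAt d G = pairCoeff (fun d => coeffAt d P) i j d) :
    (MvPolynomial.X i - MvPolynomial.X j) * G =
      MvPolynomial.X i ^ 2 * MvPolynomial.pderiv i P -
        MvPolynomial.X j ^ 2 * MvPolynomial.pderiv j P := by
  refine ext_coeffAt fun d => ?_
  rw [sub_mul, map_sub, map_sub, coeffAt_X_mul, coeffAt_X_mul, coeffAt_X_sq_mul_pderiv,
    coeffAt_X_sq_mul_pderiv]
  rcases hi : d i with _ | p
  · rcases hj : d j with _ | q
    · simp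
    · have h1 : Function.update d j q i = 0 := by rw [Function.update_of_ne hij, hi]
      simp [hG, pairCoeff, h1]
  · rcases hj : d j with _ | q
    · have h1 : Function.update d i p j = 0 := by rw [Function.update_of_ne hij.symm, hj]
      simp [hG, pairCoeff, h1]
    -- After lowering one of the exponents p + 1 and q + 1, the entries i and j add up to p + q + 1.
    -- F reads the coefficients along this line, and the swap of i and j makes it symmetric.
    · set F : ℕ → QAlpha := fun a =>
        coeffAt (Function.update (Function.update d i a) j (p + q + 1 - a)) P with hFdef
      have hF : ∀ a b, a + b = p + q + 1 → F a = F b := by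
        intro a b hab
        rw [hFdef]
        simp only
        rw [← isSymmetric_iff.mp hP (Equiv.swap i j)]
        congr 2
        funext k
        by_cases hki : k = i
        · subst hki
          simp only [Function.comp, Equiv.swap_apply_left, Function.update_self,
            Function.update_of_ne hij]
          omega
        · by_cases hkj : k = j
          · subst hkj
            simp only [Function.comp, Equiv.swap_apply_right, Function.update_self,
              Function.update_of_ne hij]
            omega
          · simp [Equiv.swap_apply_of_ne_of_ne hki hkj, hki, hkj]
      have e1 : Function.update d i p =
          Function.update (Function.update d i p) j (p + q + 1 - p) := by
        rw [Function.update_comm hij, show p + q + 1 - p = d j by omega, Function.update_eq_self]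
      have e2 : Function.update d j q =
          Function.update (Function.update d i (p + 1)) j (p + q + 1 - (p + 1)) := by
        rw [show p + 1 = d i by omega, Function.update_eq_self]
        congr 1
        omega
      have s1 : ∀ a, coeffAt (spread (Function.update d i p) i j a) P = F a := by
        intro a
        simp only [hFdef, spread, Function.update_self, Function.update_idem,
          Function.update_of_ne hij.symm, hj]
        rfl
      have s2 : ∀ a, coeffAt (spread (Function.update d j q) i j a) P = F a := by
        intro a
        simp only [hFdef, spread, Function.update_self, Function.update_of_ne hij, hi]
        rw [Function.update_comm hij.symm, Function.update_idem]
        congr 3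
        omega
      have t := pairCoeff_telescope p q hF
      have f1 : coeffAt (Function.update d i p) P = F p := by rw [e1]
      have f2 : coeffAt (Function.update d j q) P = F (p + 1) := by rw [e2]
      simp only [Nat.add_one_sub_one, Nat.add_eq_zero_iff, one_ne_zero, and_false, if_false, hG,
        pairCoeff, s1, s2, f1, f2, Function.update_self, Function.update_of_ne hij,
        Function.update_of_ne hij.symm, hi, hj]
      rw [← t]
      congr 4
      all_goals
        funext a
        congr 3
        omega

/-- The operator `f ↦ (x_i² ∂_i f - x_j² ∂_j f) / (x_i - x_j)` on symmetric polynomials that are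
homogeneous of degree `n`. -/
def pairOp (N n : ℕ) (i j : Fin N) :
    MvPolynomial (Fin N) QAlpha →ₗ[QAlpha] MvPolynomial (Fin N) QAlpha :=
  ∑ d ∈ Finset.piAntidiag Finset.univ n,
    (MvPolynomial.monomial (R := QAlpha) (Finsupp.equivFunOnFinite.symm d)) ∘ₗ
      (((max (d i) (d j) : ℕ) : QAlpha) • coeffAt d +
        ∑ a ∈ Finset.range (min (d i) (d j)),
          ((d i + d j - 2 * a : ℕ) : QAlpha) • coeffAt (spread d i j a))

theorem coeffAt_pairOp (n : ℕ) (i j : Fin N) (P : MvPolynomial (Fin N) QAlpha)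
    (d : Fin N → ℕ) : coeffAt d (pairOp N n i j P) =
      if ∑ k, d k = n then pairCoeff (fun d => coeffAt d P) i j d else 0 := by
  simp only [pairOp, LinearMap.sum_apply, LinearMap.comp_apply, map_sum, coeffAt_monomial]
  simp only [Finsupp.coe_equivFunOnFinite_symm]
  simp [pairCoeff]

/-- All monomials of `P` have degree `n`. -/
def HasDegree (n : ℕ) (P : MvPolynomial (Fin N) QAlpha) : Prop :=
  ∀ d : Fin N → ℕ, coeffAt d P ≠ 0 → ∑ k, d k = n

theorem sum_spread (d : Fin N → ℕ) {i j : Fin N} (h : i ≠ j) {a : ℕ} (ha : a ≤ d i + d j) :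
    ∑ k, spread d i j a k = ∑ k, d k := by
  rw [sum_eq_add_add_sum_compl h, sum_eq_add_add_sum_compl h, spread_left d h,
      spread_right, sum_spread_of_notMem d a (by simp) (by simp)]
  omega

theorem coeffAt_pairOp_of_hasDegree {n : ℕ} {i j : Fin N} (h : i ≠ j)
    {P : MvPolynomial (Fin N) QAlpha} (hP : HasDegree n P) (d : Fin N → ℕ) :
    coeffAt d (pairOp N n i j P) = pairCoeff (fun d => coeffAt d P) i j d := by
  rw [coeffAt_pairOp]
  split_ifs with hd
  · rfl
  · rw [pairCoeff]
    have h1 : coeffAt d P = 0 := not_not.mp fun h0 => hd (hP d h0)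
    rw [h1, mul_zero, zero_add, Finset.sum_eq_zero]
    intro a ha
    rw [Finset.mem_range] at ha
    have h2 : coeffAt (spread d i j a) P = 0 := not_not.mp fun h0 => hd (by
      rw [← hP _ h0, sum_spread d h (by omega)])
    rw [h2, mul_zero]

/-- The operator `D_1` on symmetric polynomials that are homogeneous of degree `n`. -/
def D1Op (N n : ℕ) : MvPolynomial (Fin N) QAlpha →ₗ[QAlpha] MvPolynomial (Fin N) QAlpha :=
  (1 / 2 : QAlpha) • ∑ i : Fin N, ∑ j ∈ Finset.univ.filter (fun j : Fin N => j ≠ i),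
    pairOp N n i j

theorem sum_ne_comm {M : Type*} [AddCommMonoid M] (f : Fin N → Fin N → M) :
    ∑ i : Fin N, ∑ j ∈ Finset.univ.filter (fun j : Fin N => j ≠ i), f i j =
      ∑ i : Fin N, ∑ j ∈ Finset.univ.filter (fun j : Fin N => j ≠ i), f j i := by
  simp only [Finset.sum_filter]
  rw [Finset.sum_comm]
  simp only [ne_comm]

/-- The poles at x_i = x_j cancel between the terms (i, j) and (j, i), whose sum is a polynomial
divided difference. The sum over ordered pairs counts each of these twice, whence the 1/2 in `D1Op`.
-/
theorem D1_eq_toRat {n : ℕ} {P : MvPolynomial (Fin N) QAlpha} (hs : P.IsSymmetric)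
    (hP : HasDegree n P) : D1 N P = toRat N (D1Op N n P) := by
  set A : Fin N → Fin N → RatField N := fun i j =>
    toRat N (MvPolynomial.X i ^ 2) / toRat N (MvPolynomial.X i - MvPolynomial.X j)
      * toRat N (MvPolynomial.pderiv i P) with hA
  have hpair : ∀ i j : Fin N, j ≠ i → A i j + A j i = toRat N (pairOp N n i j P) := by
    intro i j hij
    have h := congrArg (toRat N) (sub_mul_eq_of_pairCoeff hs hij.symm
      (coeffAt_pairOp_of_hasDegree hij.symm hP))
    have hX : (MvPolynomial.X i - MvPolynomial.X j : MvPolynomial (Fin N) QAlpha) ≠ 0 := by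
      rw [sub_ne_zero]
      exact fun h => hij (MvPolynomial.X_injective h).symm
    have h0 : toRat N (MvPolynomial.X i - MvPolynomial.X j) ≠ 0 := by
      rw [Ne, map_eq_zero_iff _ (IsFractionRing.injective (MvPolynomial (Fin N) QAlpha) _)]
      exact hX
    have h1 : toRat N (MvPolynomial.X j - MvPolynomial.X i) =
        -toRat N (MvPolynomial.X i - MvPolynomial.X j) := by
      rw [← map_neg, neg_sub]
    rw [map_mul, RingHom.map_sub _ (MvPolynomial.X i ^ 2 * _), map_mul, map_mul] at h
    rw [hA]
    simp only
    rw [h1]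
    field_simp
    rw [mul_comm (toRat N (MvPolynomial.X i - MvPolynomial.X j))] at h ⊢
    rw [h]
    ring
  have h2 : D1 N P + D1 N P = ∑ i : Fin N,
      ∑ j ∈ Finset.univ.filter (fun j : Fin N => j ≠ i), toRat N (pairOp N n i j P) := by
    have e : D1 N P = ∑ i : Fin N,
      ∑ j ∈ Finset.univ.filter (fun j : Fin N => j ≠ i), A i j := rfl
    nth_rewrite 2 [e]
    rw [sum_ne_comm, e]
    simp only [← Finset.sum_add_distrib]
    refine Finset.sum_congr rfl fun i _ => Finset.sum_congr rfl fun j hj => ?_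
    exact hpair i j (Finset.mem_filter.mp hj).2
  have h3 : D1Op N n P + D1Op N n P = ∑ i : Fin N,
      ∑ j ∈ Finset.univ.filter (fun j : Fin N => j ≠ i), pairOp N n i j P := by
    rw [D1Op, LinearMap.smul_apply, ← add_smul]
    norm_num [LinearMap.sum_apply]
  have h4 := congrArg (toRat N) h3
  simp only [map_add, map_sum] at h4
  rw [← h4, ← two_mul, ← two_mul] at h2
  exact mul_left_cancel₀ two_ne_zero h2

/-- The Laplace-Beltrami operator on symmetric polynomials that are homogeneous of degree `n`. -/
def laplaceOp (N n : ℕ) (P : MvPolynomial (Fin N) QAlpha) : MvPolynomial (Fin N) QAlpha :=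
  D1Op N n P + MvPolynomial.C alpha * D2 N P

theorem laplaceBeltrami_eq_toRat {n : ℕ} {P : MvPolynomial (Fin N) QAlpha}
    (hs : P.IsSymmetric) (hP : HasDegree n P) :
    laplaceBeltrami N P = toRat N (laplaceOp N n P) := by
  rw [laplaceBeltrami, D1_eq_toRat hs hP, laplaceOp, map_add]

end Operator

/-! ### Triangularity and inversion of the shifted operator. -/

section Triangular

variable {N : ℕ}

theorem sum_ne_max (d : Fin N → ℕ) :
    ∑ i : Fin N, ∑ j ∈ Finset.univ.filter (fun j : Fin N => j ≠ i), (max (d i) (d j) : ℕ) +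
      ∑ i, d i = maxSum d := by
  rw [maxSum, ← Finset.sum_add_distrib]
  refine Finset.sum_congr rfl fun i _ => ?_
  rw [Finset.filter_ne', add_comm, ← Finset.add_sum_erase _ _ (Finset.mem_univ i), max_self]

/-- The diagonal entry of the Laplace-Beltrami operator at the exponent vector `d`. -/
def diagEntry (d : Fin N → ℕ) : QAlpha :=
  ((maxSum d : QAlpha) - ((∑ i, d i : ℕ) : QAlpha)) / 2 +
    alpha * ((∑ i, (d i).choose 2 : ℕ) : QAlpha)

/-- The off-diagonal part of the Laplace-Beltrami operator on coefficients. -/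
def spreadSum (f : (Fin N → ℕ) → QAlpha) (d : Fin N → ℕ) : QAlpha :=
  1 / 2 * ∑ i : Fin N, ∑ j ∈ Finset.univ.filter (fun j : Fin N => j ≠ i),
    ∑ a ∈ Finset.range (min (d i) (d j)),
      ((d i + d j - 2 * a : ℕ) : QAlpha) * f (spread d i j a)

theorem coeffAt_laplaceOp_eq_pairCoeff {n : ℕ} {P : MvPolynomial (Fin N) QAlpha} (hP : HasDegree n P)
    (d : Fin N → ℕ) : coeffAt d (laplaceOp N n P) =
      1 / 2 * (∑ i : Fin N, ∑ j ∈ Finset.univ.filter (fun j : Fin N => j ≠ i),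
        pairCoeff (fun d => coeffAt d P) i j d) +
      alpha * (((∑ i, (d i).choose 2 : ℕ) : QAlpha) * coeffAt d P) := by
  have h1 : coeffAt d (D1Op N n P) = 1 / 2 * ∑ i : Fin N,
      ∑ j ∈ Finset.univ.filter (fun j : Fin N => j ≠ i),
        pairCoeff (fun d => coeffAt d P) i j d := by
    simp only [D1Op, LinearMap.smul_apply, LinearMap.sum_apply, map_smul, map_sum, smul_eq_mul]
    congr 1
    refine Finset.sum_congr rfl fun i _ => Finset.sum_congr rfl fun j hj => ?_
    exact coeffAt_pairOp_of_hasDegree (Finset.mem_filter.mp hj).2.symm hP d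
  rw [laplaceOp, map_add, h1, coeffAt_C_mul, coeffAt_D2]

theorem coeffAt_laplaceOp {n : ℕ} {P : MvPolynomial (Fin N) QAlpha} (hP : HasDegree n P)
    (d : Fin N → ℕ) : coeffAt d (laplaceOp N n P) =
      diagEntry d * coeffAt d P + spreadSum (fun d => coeffAt d P) d := by
  have h2 := congrArg (Nat.cast (R := QAlpha)) (sum_ne_max d)
  push_cast at h2
  rw [coeffAt_laplaceOp_eq_pairCoeff hP]
  simp only [pairCoeff, Finset.sum_add_distrib, ← Finset.sum_mul, spreadSum, diagEntry]
  rw [← h2]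
  push_cast
  ring

theorem sum_range_eq_choose_two (n : ℕ) : ∑ i ∈ Finset.range n, i = n.choose 2 := by
  rw [Finset.sum_range_id, Nat.choose_two_right]

theorem sum_cells {M : Type*} [AddCommMonoid M] {lam : YoungDiagram} {N : ℕ}
    (hN : lam.colLen 0 ≤ N) (f : ℕ × ℕ → M) :
    ∑ c ∈ lam.cells, f c = ∑ k ∈ Finset.range N, ∑ c ∈ Finset.range (lam.rowLen k), f (k, c) :=
  prod_cells (M := Multiplicative M) hN f

theorem bStat_transpose {lam : YoungDiagram} (hN : lam.colLen 0 ≤ N) :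
    bStat lam.transpose = ∑ k ∈ Finset.range N, k * lam.rowLen k := by
  have h1 : bStat lam.transpose = ∑ c ∈ lam.transpose.cells, c.2 := by
    rw [sum_cells le_rfl, bStat]
    exact Finset.sum_congr rfl fun k _ => (sum_range_eq_choose_two _).symm
  have h2 : ∑ c ∈ lam.transpose.cells, c.2 = ∑ c ∈ lam.cells, c.1 := by
    refine Finset.sum_nbij' Prod.swap Prod.swap ?_ ?_ ?_ ?_ ?_ <;> intro c
    · simp
    · simp
    · simp
    · simp
    · simp
  rw [h1, h2, sum_cells hN]
  refine Finset.sum_congr rfl fun k _ => ?_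
  rw [Finset.sum_const, Finset.card_range, smul_eq_mul, mul_comm]

theorem bStat_eq {lam : YoungDiagram} (hN : lam.colLen 0 ≤ N) :
    bStat lam = ∑ i, (rowVec N lam i).choose 2 := by
  have h := Fin.sum_univ_eq_sum_range (fun k => (lam.rowLen k).choose 2) N
  refine Eq.trans ?_ h.symm
  refine Finset.sum_subset (Finset.range_mono hN) fun k _ hk => ?_
  rw [Finset.mem_range, not_lt, ← rowLen_eq_zero_iff] at hk
  simp [hk]

/-- With rows counted from 0, the partial sums add up to ∑ (N - i) λ_i, and b(λᵗ) = ∑ i λ_i. -/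
theorem maxSum_rowVec {lam : YoungDiagram} (hN : lam.colLen 0 ≤ N) :
    maxSum (rowVec N lam) + lam.card + 2 * bStat lam.transpose = 2 * (N * lam.card) := by
  have h1 := maxSum_add_sum_of_antitone (rowVec_antitone (N := N) lam)
  rw [sum_rowVec hN] at h1
  rw [h1, bStat_transpose hN, ← mul_add]
  congr 1
  have h2 : ∑ j, ∑ i ∈ Finset.Iic j, rowVec N lam i = ∑ i : Fin N, (N - i) * rowVec N lam i := by
    rw [Finset.sum_comm' (t' := Finset.univ) (s' := fun i => Finset.Ici i)]
    · refine Finset.sum_congr rfl fun i _ => ?_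
      rw [Finset.sum_const, Fin.card_Ici, smul_eq_mul]
    · simp
  have h3 : ∑ k ∈ Finset.range N, k * lam.rowLen k = ∑ i : Fin N, (i : ℕ) * rowVec N lam i :=
    (Fin.sum_univ_eq_sum_range (fun k => k * lam.rowLen k) N).symm
  rw [h2, h3, ← Finset.sum_add_distrib, ← sum_rowVec hN, Finset.mul_sum]
  refine Finset.sum_congr rfl fun i _ => ?_
  rw [← add_mul, Nat.sub_add_cancel i.2.le]

theorem eigenvalue_eq_diagEntry {lam : YoungDiagram} (hN : lam.colLen 0 ≤ N) :
    eigenvalue N lam = diagEntry (rowVec N lam) := by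
  have h := congrArg (Nat.cast (R := QAlpha)) (maxSum_rowVec hN)
  push_cast at h
  rw [eigenvalue, diagEntry, sum_rowVec hN, bStat_eq hN]
  linear_combination (-1 / 2 : QAlpha) * h

/-- All monomials of `P` are dominated by `lam`. -/
def SupportDominated (lam : YoungDiagram) (P : MvPolynomial (Fin N) QAlpha) : Prop :=
  ∀ d : Fin N → ℕ, coeffAt d P ≠ 0 → DominatedBy lam d

theorem SupportDominated.hasDegree {lam : YoungDiagram} {P : MvPolynomial (Fin N) QAlpha}
    (h : SupportDominated lam P) : HasDegree lam.card P := fun d hd => (h d hd).1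

/-- The value at α = 0 is nonzero as soon as the `maxSum` differ; this is why inverting the
triangular system creates no pole there. -/
theorem diagEntry_sub_diagEntry (d e : Fin N → ℕ) (h : ∑ i, d i = ∑ i, e i) :
    diagEntry d - diagEntry e = algebraMap ℚ QAlpha (((maxSum d : ℚ) - maxSum e) / 2) +
      alpha * algebraMap ℚ QAlpha
        (((∑ i, (d i).choose 2 : ℕ) : ℚ) - ((∑ i, (e i).choose 2 : ℕ) : ℚ)) := by
  simp only [diagEntry, h, map_div₀, map_sub, map_natCast, map_ofNat]
  ring

/-- Coefficients of a symmetric polynomial with dominated support lie in `M` as soon as the leading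
coefficient and the coefficients of its image under the shifted Laplace-Beltrami operator do. -/
theorem coeffAt_mem_of_triangular (M : Submodule ℚ QAlpha)
    (hinv : ∀ a b : ℚ, a ≠ 0 → ∀ x ∈ M,
      (algebraMap ℚ QAlpha a + alpha * algebraMap ℚ QAlpha b)⁻¹ * x ∈ M)
    {lam : YoungDiagram} (hN : lam.colLen 0 ≤ N) {P : MvPolynomial (Fin N) QAlpha}
    (hs : P.IsSymmetric) (hd : SupportDominated lam P) (htop : coeffAt (rowVec N lam) P ∈ M)
    (hP : ∀ d, coeffAt d (laplaceOp N lam.card P) - eigenvalue N lam * coeffAt d P ∈ M)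
    (d : Fin N → ℕ) : coeffAt d P ∈ M := by
  have hnat : ∀ (n : ℕ) (x : QAlpha), x ∈ M → (n : QAlpha) * x ∈ M := fun n x hx => by
    rw [← nsmul_eq_mul]
    exact M.nsmul_mem hx n
  have hhalf : ∀ x : QAlpha, x ∈ M → 1 / 2 * x ∈ M := fun x hx => by
    have := M.smul_mem (1 / 2 : ℚ) hx
    rw [Algebra.smul_def, map_div₀, map_one, map_ofNat] at this
    exact this
  -- Induction on the deficit of `maxSum`, which every spread strictly lowers.
  induction hm : maxSum (rowVec N lam) - maxSum d using Nat.strong_induction_on generalizing d with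
  | _ m ih =>
    by_cases h0 : coeffAt d P = 0
    · rw [h0]; exact M.zero_mem
    have hdom := hd d h0
    by_cases hmax : maxSum (rowVec N lam) ≤ maxSum d
    -- Zero deficit means that d is a permutation of λ, so its coefficient is the leading one.
    · obtain ⟨e, he⟩ := hdom.exists_perm hN hmax
      rw [← isSymmetric_iff.mp hs e d, he]
      exact htop
    · have hsp : spreadSum (fun d => coeffAt d P) d ∈ M := by
        refine hhalf _ (M.sum_mem fun i _ => M.sum_mem fun j hj => M.sum_mem fun a ha =>
          hnat _ _ ?_)
        have hij : i ≠ j := (Finset.mem_filter.mp hj).2.symm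
        have hlt := maxSum_lt_maxSum_spread d hij (Finset.mem_range.mp ha)
        exact ih _ (by omega) _ rfl
      have h1 := M.sub_mem (hP d) hsp
      rw [coeffAt_laplaceOp hd.hasDegree, eigenvalue_eq_diagEntry hN] at h1
      have h2 : diagEntry d * coeffAt d P + spreadSum (fun d => coeffAt d P) d -
          diagEntry (rowVec N lam) * coeffAt d P - spreadSum (fun d => coeffAt d P) d =
          (diagEntry d - diagEntry (rowVec N lam)) * coeffAt d P := by ring
      rw [h2, diagEntry_sub_diagEntry _ _ (hdom.1.trans (sum_rowVec hN).symm)] at h1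
      have ha : ((maxSum d : ℚ) - maxSum (rowVec N lam)) / 2 ≠ 0 := by
        have : (maxSum d : ℚ) < maxSum (rowVec N lam) := by exact_mod_cast not_le.mp hmax
        exact (div_neg_of_neg_of_pos (sub_neg.mpr this) two_pos).ne
      rw [← inv_mul_cancel_left₀ (algebraMap_add_alpha_mul_ne_zero _ ha) (coeffAt d P)]
      exact hinv _ _ ha _ h1

theorem eq_zero_of_triangular {lam : YoungDiagram} (hN : lam.colLen 0 ≤ N)
    {P : MvPolynomial (Fin N) QAlpha} (hs : P.IsSymmetric) (hd : SupportDominated lam P)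
    (htop : coeffAt (rowVec N lam) P = 0)
    (hP : laplaceOp N lam.card P = MvPolynomial.C (eigenvalue N lam) * P) : P = 0 := by
  refine ext_coeffAt fun d => ?_
  have := coeffAt_mem_of_triangular (⊥ : Submodule ℚ QAlpha) (fun a b _ x hx => by
    rw [Submodule.mem_bot] at hx ⊢
    rw [hx, mul_zero]) hN hs hd ((Submodule.mem_bot ℚ).mpr htop)
    (fun d => by rw [hP, coeffAt_C_mul, sub_self]; exact Submodule.zero_mem _) d
  rw [map_zero]
  exact (Submodule.mem_bot ℚ).mp this

theorem pairCoeff_comm {P : MvPolynomial (Fin N) QAlpha} (hs : P.IsSymmetric) (i j : Fin N)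
    (e : Equiv.Perm (Fin N)) (d : Fin N → ℕ) :
    pairCoeff (fun d => coeffAt d P) i j (d ∘ e) =
      pairCoeff (fun d => coeffAt d P) (e i) (e j) d := by
  have h : ∀ a, spread (d ∘ e) i j a = spread d (e i) (e j) a ∘ e := by
    intro a
    funext k
    simp only [spread, Function.comp, Function.update_apply, e.injective.eq_iff]
  simp only [pairCoeff, h, isSymmetric_iff.mp hs]
  rfl

theorem laplaceOp_isSymmetric {n : ℕ} {P : MvPolynomial (Fin N) QAlpha} (hP : HasDegree n P)
    (hs : P.IsSymmetric) : (laplaceOp N n P).IsSymmetric := by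
  refine isSymmetric_iff.mpr fun e d => ?_
  rw [coeffAt_laplaceOp_eq_pairCoeff hP, coeffAt_laplaceOp_eq_pairCoeff hP, isSymmetric_iff.mp hs]
  congr 2
  · simp only [pairCoeff_comm hs, Finset.sum_filter]
    refine Eq.trans ?_ (Equiv.sum_comp e _)
    refine Finset.sum_congr rfl fun i _ => ?_
    refine Eq.trans ?_ (Equiv.sum_comp e _)
    simp only [ne_eq, e.injective.eq_iff]
  · congr 2
    exact Equiv.sum_comp e fun i => (d i).choose 2

theorem exists_of_spreadSum_ne_zero {f : (Fin N → ℕ) → QAlpha} {d : Fin N → ℕ}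
    (h : spreadSum f d ≠ 0) : ∃ i j a, i ≠ j ∧ a < min (d i) (d j) ∧ f (spread d i j a) ≠ 0 := by
  by_contra hcon
  push Not at hcon
  refine h ?_
  rw [spreadSum, Finset.sum_eq_zero, mul_zero]
  intro i _
  refine Finset.sum_eq_zero fun j hj => Finset.sum_eq_zero fun a ha => ?_
  rw [hcon i j a (Finset.mem_filter.mp hj).2.symm (Finset.mem_range.mp ha), mul_zero]

theorem laplaceOp_supportDominated {lam : YoungDiagram} {P : MvPolynomial (Fin N) QAlpha}
    (hd : SupportDominated lam P) : SupportDominated lam (laplaceOp N lam.card P) := by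
  intro d h
  rw [coeffAt_laplaceOp hd.hasDegree] at h
  by_cases h0 : coeffAt d P = 0
  · rw [h0, mul_zero, zero_add] at h
    obtain ⟨i, j, a, hij, ha, hne⟩ := exists_of_spreadSum_ne_zero h
    exact (hd _ hne).of_spread hij ha
  · exact hd d h0

/-- A spread of λ would exceed the largest `maxSum` allowed in the support, so no off-diagonal term
reaches the leading coefficient. -/
theorem coeffAt_rowVec_laplaceOp {lam : YoungDiagram} (hN : lam.colLen 0 ≤ N)
    {P : MvPolynomial (Fin N) QAlpha} (hd : SupportDominated lam P) :
    coeffAt (rowVec N lam) (laplaceOp N lam.card P) =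
      eigenvalue N lam * coeffAt (rowVec N lam) P := by
  rw [coeffAt_laplaceOp hd.hasDegree, eigenvalue_eq_diagEntry hN, add_eq_left]
  by_contra h
  obtain ⟨i, j, a, hij, ha, hne⟩ := exists_of_spreadSum_ne_zero h
  exact absurd ((hd _ hne).maxSum_le hN)
    (not_le.mpr (maxSum_lt_maxSum_spread _ hij ha))

/-- The symmetric polynomials all of whose monomials are strictly dominated by `lam`. -/
def lowerSpace (N : ℕ) (lam : YoungDiagram) :
    Submodule QAlpha (MvPolynomial (Fin N) QAlpha) where
  carrier := {P | P.IsSymmetric ∧ SupportDominated lam P ∧ coeffAt (rowVec N lam) P = 0}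
  zero_mem' := ⟨fun e => map_zero _, fun d hd => absurd (map_zero _) hd, map_zero _⟩
  add_mem' := fun {P Q} hP hQ => ⟨hP.1.add hQ.1, fun d hd => by
    by_cases h : coeffAt d P = 0
    · exact hQ.2.1 d fun h' => hd (by rw [map_add, h, h', add_zero])
    · exact hP.2.1 d h, by rw [map_add, hP.2.2, hQ.2.2, add_zero]⟩
  smul_mem' := fun c P hP => ⟨hP.1.smul c, fun d hd => hP.2.1 d fun h => hd (by
    rw [map_smul, h, smul_zero]), by rw [map_smul, hP.2.2, smul_zero]⟩

theorem mem_lowerSpace {lam : YoungDiagram} {P : MvPolynomial (Fin N) QAlpha} :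
    P ∈ lowerSpace N lam ↔
      P.IsSymmetric ∧ SupportDominated lam P ∧ coeffAt (rowVec N lam) P = 0 := Iff.rfl

instance (lam : YoungDiagram) : FiniteDimensional QAlpha (lowerSpace N lam) := by
  have hfin : {m : Fin N →₀ ℕ | ∑ i, m i = lam.card}.Finite := by
    refine Set.Finite.subset (Finset.finite_toSet
      ((Finset.piAntidiag Finset.univ lam.card).image
        (Finsupp.equivFunOnFinite (α := Fin N) (M := ℕ)).symm)) fun m hm => ?_
    simp only [Finset.coe_image, Set.mem_image, Finset.mem_coe, Finset.mem_piAntidiag]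
    exact ⟨m, ⟨hm, fun i _ => Finset.mem_univ i⟩, Finsupp.equivFunOnFinite_symm_coe m⟩
  have := hfin.to_subtype
  have : FiniteDimensional QAlpha (MvPolynomial.restrictSupport QAlpha
      {m : Fin N →₀ ℕ | ∑ i, m i = lam.card}) :=
    Module.Basis.finiteDimensional_of_finite (MvPolynomial.basisRestrictSupport QAlpha _)
  refine Submodule.finiteDimensional_of_le
    (S₂ := MvPolynomial.restrictSupport QAlpha {m : Fin N →₀ ℕ | ∑ i, m i = lam.card})
    fun P hP => ?_
  rw [MvPolynomial.mem_restrictSupport_iff]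
  intro m hm
  have : coeffAt m P ≠ 0 := by
    rw [← coeff_eq_coeffAt]
    exact MvPolynomial.mem_support_iff.mp hm
  exact ((mem_lowerSpace.mp hP).2.1 _ this).1

/-- The shifted Laplace-Beltrami operator as a linear map. -/
def shiftedOp (N n : ℕ) (c : QAlpha) :
    MvPolynomial (Fin N) QAlpha →ₗ[QAlpha] MvPolynomial (Fin N) QAlpha where
  toFun P := laplaceOp N n P - MvPolynomial.C c * P
  map_add' P Q := by
    simp only [laplaceOp, D2, map_add, mul_add, Finset.sum_add_distrib]
    ring
  map_smul' r P := by
    simp only [laplaceOp, D2, map_smul, mul_smul_comm, ← Finset.smul_sum, RingHom.id_apply,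
      smul_sub, smul_add, Derivation.map_smul]

theorem shiftedOp_apply (n : ℕ) (c : QAlpha) (P : MvPolynomial (Fin N) QAlpha) :
    shiftedOp N n c P = laplaceOp N n P - MvPolynomial.C c * P := rfl

theorem shiftedOp_mem_lowerSpace {lam : YoungDiagram} (hN : lam.colLen 0 ≤ N)
    {P : MvPolynomial (Fin N) QAlpha} (hs : P.IsSymmetric) (hd : SupportDominated lam P) :
    shiftedOp N lam.card (eigenvalue N lam) P ∈ lowerSpace N lam := by
  refine mem_lowerSpace.mpr ⟨?_, fun d h => ?_, ?_⟩
  · rw [shiftedOp_apply]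
    exact (laplaceOp_isSymmetric hd.hasDegree hs).sub ((MvPolynomial.IsSymmetric.C _).mul hs)
  · by_cases h0 : coeffAt d P = 0
    · rw [shiftedOp_apply, map_sub, coeffAt_C_mul, h0, mul_zero, sub_zero] at h
      exact laplaceOp_supportDominated hd d h
    · exact hd d h0
  · rw [shiftedOp_apply, map_sub, coeffAt_C_mul, coeffAt_rowVec_laplaceOp hN hd, sub_self]

/-- The shifted Laplace-Beltrami operator is onto the strictly dominated polynomials. -/
theorem exists_shiftedOp_eq {lam : YoungDiagram} (hN : lam.colLen 0 ≤ N)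
    {Q : MvPolynomial (Fin N) QAlpha} (hQ : Q ∈ lowerSpace N lam) :
    ∃ P ∈ lowerSpace N lam, shiftedOp N lam.card (eigenvalue N lam) P = Q := by
  let T : lowerSpace N lam →ₗ[QAlpha] lowerSpace N lam :=
    (shiftedOp N lam.card (eigenvalue N lam)).restrict fun P hP =>
      shiftedOp_mem_lowerSpace hN (mem_lowerSpace.mp hP).1 (mem_lowerSpace.mp hP).2.1
  have hinj : Function.Injective T := by
    rw [injective_iff_map_eq_zero]
    rintro ⟨P, hP⟩ h
    have h' : shiftedOp N lam.card (eigenvalue N lam) P = 0 := congrArg Subtype.val h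
    rw [shiftedOp_apply, sub_eq_zero] at h'
    exact Subtype.ext (eq_zero_of_triangular hN hP.1 hP.2.1 hP.2.2 h')
  -- Uniqueness gives existence, since the space of lower terms is finite-dimensional.
  obtain ⟨⟨P, hP⟩, h⟩ := LinearMap.injective_iff_surjective.mp hinj ⟨Q, hQ⟩
  exact ⟨P, hP, congrArg Subtype.val h⟩

end Triangular

/-! ### Monomial symmetric polynomials; existence and uniqueness of Jack polynomials. -/

section Jack

variable {N : ℕ}

/-- The multiset of nonzero entries of an exponent vector. -/
def nonzeroEntries (d : Fin N → ℕ) : Multiset ℕ := (Finset.univ.val.map d).filter (· ≠ 0)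

theorem nonzeroEntries_comp_perm (d : Fin N → ℕ) (e : Equiv.Perm (Fin N)) :
    nonzeroEntries (d ∘ e) = nonzeroEntries d := by
  have h : Finset.univ.val.map e = (Finset.univ : Finset (Fin N)).val :=
    congrArg Finset.val (Finset.map_univ_equiv e)
  unfold nonzeroEntries
  conv_rhs => rw [← h, Multiset.map_map]

theorem nonzeroEntries_rowVec {lam : YoungDiagram} (hN : lam.colLen 0 ≤ N) :
    nonzeroEntries (rowVec N lam) = (lam.rowLens : Multiset ℕ) := by
  have h1 : (Finset.univ : Finset (Fin N)).val.map (rowVec N lam) =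
      (Multiset.range N).map lam.rowLen := by
    have : (Finset.univ : Finset (Fin N)).val.map (fun i : Fin N => (i : ℕ)) = Multiset.range N :=
      congrArg Finset.val (Fin.map_valEmbedding_univ.trans (Nat.Iio_eq_range N))
    rw [← this, Multiset.map_map]
    rfl
  obtain ⟨m, rfl⟩ := Nat.exists_eq_add_of_le hN
  rw [nonzeroEntries, h1, Multiset.range_add, Multiset.map_add, Multiset.filter_add,
    Multiset.map_map]
  rw [Multiset.filter_eq_self.mpr, Multiset.filter_eq_nil.mpr]
  · rw [add_zero]; rfl
  · intro a ha
    obtain ⟨k, _, rfl⟩ := Multiset.mem_map.mp ha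
    rw [not_not]
    exact rowLen_eq_zero_iff.mpr (Nat.le_add_right _ _)
  · intro a ha
    obtain ⟨k, hk, rfl⟩ := Multiset.mem_map.mp ha
    rw [Ne, rowLen_eq_zero_iff, not_le]
    exact Multiset.mem_range.mp hk

theorem rowLens_injective {lam nu : YoungDiagram}
    (h : (lam.rowLens : Multiset ℕ) = (nu.rowLens : Multiset ℕ)) : lam = nu := by
  have h1 := (Multiset.coe_eq_coe.mp h).eq_of_sortedGE lam.rowLens_sorted nu.rowLens_sorted
  exact YoungDiagram.equivListRowLens.injective (Subtype.ext h1)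

theorem exists_shape (d : Fin N → ℕ) : ∃ lam : YoungDiagram, lam.colLen 0 ≤ N ∧
    ∃ e : Equiv.Perm (Fin N), d ∘ e = rowVec N lam := by
  obtain ⟨e, he⟩ := exists_perm_antitone d
  refine ⟨YoungDiagram.ofRowLens (List.ofFn (d ∘ e)) (List.sortedGE_ofFn_iff.mpr he), ?_, e, ?_⟩
  · by_contra h
    have h1 := YoungDiagram.mem_iff_lt_colLen.mpr (not_le.mp h)
    obtain ⟨h2, _⟩ := YoungDiagram.mem_ofRowLens.mp h1
    simp at h2
  · funext i
    have := YoungDiagram.rowLen_ofRowLens (hw := List.sortedGE_ofFn_iff.mpr he)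
      (Fin.cast List.length_ofFn.symm i)
    rw [rowVec]
    simpa using this.symm

/-- The partition obtained by sorting an exponent vector. -/
def shape (d : Fin N → ℕ) : YoungDiagram := (exists_shape d).choose

theorem colLen_shape_le (d : Fin N → ℕ) : (shape d).colLen 0 ≤ N := (exists_shape d).choose_spec.1

theorem exists_perm_shape (d : Fin N → ℕ) :
    ∃ e : Equiv.Perm (Fin N), d ∘ e = rowVec N (shape d) := (exists_shape d).choose_spec.2

theorem nonzeroEntries_eq_rowLens_shape (d : Fin N → ℕ) :
    nonzeroEntries d = ((shape d).rowLens : Multiset ℕ) := by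
  obtain ⟨e, he⟩ := exists_perm_shape d
  rw [← nonzeroEntries_comp_perm d e, he, nonzeroEntries_rowVec (colLen_shape_le d)]

theorem shape_rowVec {lam : YoungDiagram} (hN : lam.colLen 0 ≤ N) :
    shape (rowVec N lam) = lam :=
  rowLens_injective (by rw [← nonzeroEntries_eq_rowLens_shape, nonzeroEntries_rowVec hN])

theorem prod_map_X (s : Multiset (Fin N)) :
    (s.map (MvPolynomial.X (R := QAlpha))).prod = MvPolynomial.monomial (Multiset.toFinsupp s) 1 := by
  induction s using Multiset.induction_on with
  | empty => simp
  | cons a s ih =>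
    rw [Multiset.map_cons, Multiset.prod_cons, ih, ← Multiset.singleton_add,
      Multiset.toFinsupp_add, Multiset.toFinsupp_singleton, MvPolynomial.X,
      MvPolynomial.monomial_mul, one_mul]

/-- An exponent vector determines the multiset of variables of its monomial, so at most one summand
contributes. -/
theorem coeffAt_msymm {n : ℕ} (mu : n.Partition) (d : Fin N → ℕ) :
    coeffAt d (MvPolynomial.msymm (Fin N) QAlpha mu) =
      if nonzeroEntries d = mu.parts then 1 else 0 := by
  have hparts : ∀ s : Sym (Fin N) n, (Multiset.toFinsupp s.1 : Fin N → ℕ) = d →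
      (Nat.Partition.ofSym s).parts = nonzeroEntries d := by
    intro s hs
    have hc : ∀ i, Multiset.count i s.1 = d i := fun i => congrFun hs i
    have h1 : s.1.dedup = Finset.univ.val.filter fun i => d i ≠ 0 := by
      refine congrArg Finset.val (?_ : s.1.toFinset = Finset.univ.filter fun i => d i ≠ 0)
      ext i
      rw [Multiset.mem_toFinset, Finset.mem_filter, ← hc, Multiset.count_ne_zero]
      simp
    change s.1.dedup.map (fun i => Multiset.count i s.1) = _
    rw [h1, nonzeroEntries, Multiset.filter_map]
    exact Multiset.map_congr rfl fun i _ => hc i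
  rw [MvPolynomial.msymm, map_sum]
  simp only [prod_map_X, coeffAt_monomial]
  split_ifs with h
  · have hcard : (Finsupp.equivFunOnFinite.symm d).toMultiset.card = n := by
      rw [Finsupp.card_toMultiset, Finsupp.sum_fintype _ _ (fun _ => rfl), ← mu.parts_sum, ← h,
        nonzeroEntries]
      have : ∀ m : Multiset ℕ, (m.filter (· ≠ 0)).sum = m.sum := by
        intro m
        induction m using Multiset.induction_on with
        | empty => simp
        | cons a m ih =>
          by_cases ha : a = 0
          · simpa [ha] using ih
          · simpa [ha] using ih
      rw [this]
      rfl
    let s0 : Sym (Fin N) n := ⟨(Finsupp.equivFunOnFinite.symm d).toMultiset, hcard⟩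
    have hs0 : (Multiset.toFinsupp s0.1 : Fin N → ℕ) = d := by
      simp [s0]
    rw [Finset.sum_eq_single ⟨s0, Nat.Partition.ext ((hparts s0 hs0).trans h)⟩]
    · rw [if_pos hs0]
    · rintro ⟨s, hs⟩ _ hne
      refine if_neg fun heq => hne (Subtype.ext (Subtype.ext ?_))
      apply Multiset.toFinsupp.injective
      exact DFunLike.coe_injective (heq.trans hs0.symm)
    · exact fun hn => absurd (Finset.mem_univ _) hn
  · refine Finset.sum_eq_zero fun s _ => if_neg fun heq => h ?_
    rw [← hparts s.1 heq, s.2]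

open Classical in
theorem coeffAt_monomialSymm (d : Fin N → ℕ) (nu : YoungDiagram) :
    coeffAt d (monomialSymm N nu) = if shape d = nu then 1 else 0 := by
  rw [monomialSymm, coeffAt_msymm, nonzeroEntries_eq_rowLens_shape]
  refine if_congr ?_ rfl rfl
  have h : (Nat.Partition.ofMultiset (nu.rowLens : Multiset ℕ)).parts =
      (nu.rowLens : Multiset ℕ) := by
    rw [Nat.Partition.ofMultiset_parts]
    exact Multiset.filter_eq_self.mpr fun a ha =>
      (YoungDiagram.pos_of_mem_rowLens nu a ha).ne'
  rw [h]
  exact ⟨fun h => rowLens_injective h, fun h => by rw [h]⟩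

theorem monomialSymm_isSymmetric (nu : YoungDiagram) : (monomialSymm N nu).IsSymmetric :=
  MvPolynomial.msymm_isSymmetric _ _ _

theorem coeffAt_eq_coeffAt_shape {P : MvPolynomial (Fin N) QAlpha} (hs : P.IsSymmetric)
    (d : Fin N → ℕ) : coeffAt d P = coeffAt (rowVec N (shape d)) P := by
  obtain ⟨e, he⟩ := exists_perm_shape d
  rw [← he, isSymmetric_iff.mp hs]

theorem dominatedBy_iff_shape {lam : YoungDiagram} (d : Fin N → ℕ) :
    DominatedBy lam d ↔ DominatedBy lam (rowVec N (shape d)) := by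
  obtain ⟨e, he⟩ := exists_perm_shape d
  rw [← he]
  refine ⟨fun h => h.comp_perm e, fun h => ?_⟩
  have := h.comp_perm e⁻¹
  have h2 : (d ∘ e) ∘ (e⁻¹ : Equiv.Perm (Fin N)) = d := by
    funext i
    simp
  rwa [h2] at this

theorem sum_range_rowLen_le {nu lam : YoungDiagram} (hnu : nu.colLen 0 ≤ N)
    (hlam : lam.colLen 0 ≤ N) (h : DominatedBy lam (rowVec N nu)) (j : ℕ) :
    ∑ i ∈ Finset.range j, nu.rowLen i ≤ ∑ i ∈ Finset.range j, lam.rowLen i := by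
  rcases le_total j N with hj | hj
  · have h1 := h.2 (Finset.univ.map (Fin.castLEEmb hj))
    rw [Finset.sum_map, Finset.card_map, Finset.card_univ, Fintype.card_fin] at h1
    refine le_trans (le_of_eq ?_) h1
    exact (Fin.sum_univ_eq_sum_range (fun k => nu.rowLen k) j).symm
  · rw [sum_range_rowLen (hnu.trans hj), sum_range_rowLen (hlam.trans hj), ← h.1,
      sum_rowVec hnu]

/-- The coefficientwise characterization of the Jack polynomial. -/
theorem isJack_iff {lam : YoungDiagram} (hN : lam.colLen 0 ≤ N)
    {P : MvPolynomial (Fin N) QAlpha} : IsJack N lam P ↔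
      P.IsSymmetric ∧ SupportDominated lam P ∧ coeffAt (rowVec N lam) P = hook lam ∧
        laplaceOp N lam.card P = MvPolynomial.C (eigenvalue N lam) * P := by
  classical
  have heig : P.IsSymmetric → SupportDominated lam P →
      (laplaceBeltrami N P = toRat N (MvPolynomial.C (eigenvalue N lam) * P) ↔
        laplaceOp N lam.card P = MvPolynomial.C (eigenvalue N lam) * P) := by
    intro hs hd
    rw [laplaceBeltrami_eq_toRat hs hd.hasDegree]
    exact (IsFractionRing.injective (MvPolynomial (Fin N) QAlpha) (RatField N)).eq_iff
  constructor
  · rintro ⟨hs, he, a, ha, hP⟩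
    have hcoeff : ∀ d : Fin N → ℕ, coeffAt d P = hook lam * (if shape d = lam then 1 else 0) +
        ∑ nu ∈ a.support, a nu * (if shape d = nu then 1 else 0) := by
      intro d
      rw [hP]
      simp only [map_add, map_sum, coeffAt_C_mul, coeffAt_monomialSymm]
    have hd : SupportDominated lam P := by
      intro d h
      rw [dominatedBy_iff_shape]
      by_cases hsh : shape d = lam
      · rw [hsh]
        exact dominatedBy_self hN
      · rw [hcoeff, if_neg hsh, mul_zero, zero_add] at h
        obtain ⟨nu, hnu, hne⟩ := Finset.exists_ne_zero_of_sum_ne_zero h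
        have : shape d = nu := by
          by_contra hcon
          exact hne (by rw [if_neg hcon, mul_zero])
        obtain ⟨h1, _, h2⟩ := ha nu hnu
        subst this
        exact dominatedBy_of_rowLen (colLen_shape_le d) h1 h2
    refine ⟨hs, hd, ?_, (heig hs hd).mp he⟩
    rw [hcoeff, shape_rowVec hN, if_pos rfl, mul_one, Finset.sum_eq_zero, add_zero]
    intro nu hnu
    rw [if_neg fun h => (ha nu hnu).2.1 h.symm, mul_zero]
  · rintro ⟨hs, hd, htop, he⟩
    refine ⟨hs, (heig hs hd).mpr he, ?_⟩
    -- The shapes of exponent vectors of degree |λ|, other than λ itself: a finite set containing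
    -- every index that can occur in the expansion.
    set F : Finset YoungDiagram := ((Finset.piAntidiag (Finset.univ : Finset (Fin N))
      lam.card).image shape).erase lam with hF
    refine ⟨Finsupp.onFinset F (fun nu => if nu ∈ F then coeffAt (rowVec N nu) P else 0)
      (fun nu h => by by_contra hn; exact h (if_neg hn)), ?_, ?_⟩
    · intro nu hnu
      rw [Finsupp.mem_support_iff, Finsupp.onFinset_apply] at hnu
      split_ifs at hnu with hm
      obtain ⟨h1, h2⟩ := Finset.mem_erase.mp hm
      obtain ⟨d, _, rfl⟩ := Finset.mem_image.mp h2
      have hdom := hd _ hnu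
      refine ⟨?_, h1, sum_range_rowLen_le (colLen_shape_le d) hN hdom⟩
      rw [← hdom.1, sum_rowVec (colLen_shape_le d)]
      · exact absurd rfl hnu
    · refine ext_coeffAt fun d => ?_
      simp only [map_add, map_sum, coeffAt_C_mul, coeffAt_monomialSymm, mul_ite, mul_one, mul_zero]
      rw [Finset.sum_ite_eq]
      simp only [Finsupp.mem_support_iff, ne_eq, ite_not, Finsupp.onFinset_apply]
      rw [coeffAt_eq_coeffAt_shape hs d]
      by_cases hsh : shape d = lam
      · rw [if_pos hsh, hsh, htop]
        simp [hF]
      · rw [if_neg hsh, zero_add]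
        by_cases hm : shape d ∈ F
        · simp only [if_pos hm]
          split_ifs with h0
          · exact h0
          · rfl
        · simp only [if_neg hm, if_true]
          by_contra h0
          refine hm (Finset.mem_erase.mpr ⟨hsh, Finset.mem_image_of_mem _ ?_⟩)
          refine Finset.mem_piAntidiag.mpr ⟨?_, fun i _ => Finset.mem_univ i⟩
          exact ((dominatedBy_iff_shape d).mpr (hd _ h0)).1

/-- Start from the leading term m. The shifted operator sends m to lower terms, where it is onto, so
that (D_α - e_λ) m = (D_α - e_λ) g with g lower; the Jack polynomial is m - g. -/
theorem existsUnique_isJack {lam : YoungDiagram} (hN : lam.colLen 0 ≤ N) :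
    ∃! P : MvPolynomial (Fin N) QAlpha, IsJack N lam P := by
  classical
  simp only [isJack_iff hN]
  set m : MvPolynomial (Fin N) QAlpha := MvPolynomial.C (hook lam) * monomialSymm N lam with hm
  have hms : m.IsSymmetric := (MvPolynomial.IsSymmetric.C _).mul (monomialSymm_isSymmetric _)
  have hmd : SupportDominated lam m := by
    intro d h
    rw [hm, coeffAt_C_mul, coeffAt_monomialSymm] at h
    rw [dominatedBy_iff_shape]
    split_ifs at h with hsh
    · rw [hsh]; exact dominatedBy_self hN
    · exact absurd (mul_zero _) h
  have hmt : coeffAt (rowVec N lam) m = hook lam := by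
    rw [hm, coeffAt_C_mul, coeffAt_monomialSymm, shape_rowVec hN, if_pos rfl, mul_one]
  obtain ⟨g, hg, hTg⟩ := exists_shiftedOp_eq hN (shiftedOp_mem_lowerSpace hN hms hmd)
  obtain ⟨hgs, hgd, hgt⟩ := mem_lowerSpace.mp hg
  refine ⟨m - g, ⟨hms.sub hgs, fun d hd => ?_, ?_, ?_⟩, ?_⟩
  · by_cases h : coeffAt d m = 0
    · exact hgd d fun h' => hd (by rw [map_sub, h, h', sub_zero])
    · exact hmd d h
  · rw [map_sub, hmt, hgt, sub_zero]
  · rw [← sub_eq_zero, ← shiftedOp_apply, map_sub, hTg, sub_self]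
  · rintro Q ⟨hQs, hQd, hQt, hQ⟩
    rw [← sub_eq_zero]
    refine eq_zero_of_triangular hN (hQs.sub (hms.sub hgs)) (fun d hd => ?_) ?_ ?_
    · by_cases h : coeffAt d Q = 0
      · by_cases h' : coeffAt d m = 0
        · exact hgd d fun h'' => hd (by rw [map_sub, map_sub, h, h', h'', sub_zero, sub_zero])
        · exact hmd d h'
      · exact hQd d h
    · rw [map_sub, map_sub, hQt, hmt, hgt, sub_zero, sub_self]
    · rw [← sub_eq_zero, ← shiftedOp_apply, map_sub, map_sub, hTg, shiftedOp_apply, hQ]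
      simp

theorem jack_isJack {lam : YoungDiagram} (hN : lam.colLen 0 ≤ N) : IsJack N lam (jack N lam) := by
  have h : lam.colLen 0 ≤ N ∧ ∃ P, IsJack N lam P := ⟨hN, (existsUnique_isJack hN).exists⟩
  rw [jack, dif_pos h]
  exact h.2.choose_spec

theorem jack_eq_of_isJack {lam : YoungDiagram} (hN : lam.colLen 0 ≤ N)
    {P : MvPolynomial (Fin N) QAlpha} (h : IsJack N lam P) : jack N lam = P :=
  (existsUnique_isJack hN).unique (jack_isJack hN) h

theorem jack_eq_zero {lam : YoungDiagram} (hN : N < lam.colLen 0) : jack N lam = 0 :=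
  dif_neg fun h => absurd h.1 (not_le.mpr hN)

end Jack

/-! ### Stability under x_{N+1} = 0. -/

section Restriction

variable {N : ℕ}

/-- Extension of an exponent vector by zero. -/
def extendZero (d : Fin N → ℕ) : Fin (N + 1) → ℕ := Fin.snoc (α := fun _ => ℕ) d 0

theorem extendZero_castSucc (d : Fin N → ℕ) (i : Fin N) : extendZero d i.castSucc = d i := by
  simp [extendZero]

theorem extendZero_last (d : Fin N → ℕ) : extendZero d (Fin.last N) = 0 := by
  simp [extendZero]

theorem coeffAt_restrictLast (d : Fin N → ℕ) (P : MvPolynomial (Fin (N + 1)) QAlpha) :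
    coeffAt d (restrictLast N P) = coeffAt (extendZero d) P := by
  induction P using MvPolynomial.induction_on' with
  | monomial m c =>
    rw [restrictLast, MvPolynomial.aeval_monomial, Finsupp.prod_fintype _ _ (fun _ => pow_zero _),
      Fin.prod_univ_castSucc, coeffAt_monomial]
    simp only [Fin.snoc_castSucc, Fin.snoc_last]
    have hprod : ∏ i : Fin N, (MvPolynomial.X i : MvPolynomial (Fin N) QAlpha) ^ m i.castSucc =
        MvPolynomial.monomial
          (Finsupp.equivFunOnFinite.symm fun i : Fin N => m i.castSucc) 1 := by
      rw [MvPolynomial.monomial_eq, Finsupp.prod_fintype _ _ (fun _ => pow_zero _), map_one,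
        one_mul]
      rfl
    rw [hprod, MvPolynomial.algebraMap_eq, ← mul_assoc, MvPolynomial.C_mul_monomial, mul_one]
    by_cases hm : m (Fin.last N) = 0
    · rw [hm, pow_zero, mul_one, coeffAt_monomial]
      refine if_congr ⟨fun h => ?_, fun h => ?_⟩ rfl rfl
      · funext i
        refine Fin.lastCases ?_ (fun j => ?_) i
        · rw [hm, extendZero_last]
        · rw [extendZero_castSucc, ← h]
          rfl
      · funext i
        rw [← extendZero_castSucc d i, ← h]
        rfl
    · rw [zero_pow hm, mul_zero, map_zero, if_neg]
      intro h
      exact hm (by rw [h, extendZero_last])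
  | add p q hp hq => rw [map_add, map_add, map_add, hp, hq]

theorem nonzeroEntries_extendZero (d : Fin N → ℕ) :
    nonzeroEntries (extendZero d) = nonzeroEntries d := by
  unfold nonzeroEntries
  rw [Fin.univ_castSuccEmb, Finset.cons_val, Multiset.map_cons, extendZero_last,
    Multiset.filter_cons_of_neg _ (by simp), Finset.map_val, Multiset.map_map]
  congr 2
  funext i
  exact extendZero_castSucc d i

theorem shape_extendZero (d : Fin N → ℕ) : shape (extendZero d) = shape d :=
  rowLens_injective (by
    rw [← nonzeroEntries_eq_rowLens_shape, ← nonzeroEntries_eq_rowLens_shape,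
      nonzeroEntries_extendZero])

theorem extendZero_spread (d : Fin N → ℕ) (i j : Fin N) (a : ℕ) :
    spread (extendZero d) i.castSucc j.castSucc a = extendZero (spread d i j a) := by
  simp only [spread, extendZero_castSucc]
  simp only [extendZero, Fin.snoc_update]

theorem sum_extendZero (d : Fin N → ℕ) : ∑ i, extendZero d i = ∑ i, d i := by
  rw [Fin.sum_univ_castSucc, extendZero_last, add_zero]
  simp only [extendZero_castSucc]

theorem DominatedBy.of_extendZero {lam : YoungDiagram} {d : Fin N → ℕ}
    (h : DominatedBy lam (extendZero d)) : DominatedBy lam d := by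
  refine ⟨(sum_extendZero d).symm.trans h.1, fun S => ?_⟩
  have := h.2 (S.map Fin.castSuccEmb)
  rw [Finset.sum_map, Finset.card_map] at this
  simpa [extendZero_castSucc] using this

theorem eigenvalue_succ (lam : YoungDiagram) :
    eigenvalue (N + 1) lam = eigenvalue N lam + (lam.card : QAlpha) := by
  simp only [eigenvalue]
  push_cast
  ring

/-- On exponents vanishing at the last variable, the two ordered pairs of i and the last index
contribute d_i each. After halving they add up to the degree n, which is the shift of the eigenvalue
in `eigenvalue_succ`. -/
theorem coeffAt_extendZero_laplaceOp {n : ℕ} {P : MvPolynomial (Fin (N + 1)) QAlpha}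
    (hP : HasDegree n P) (d : Fin N → ℕ) :
    coeffAt (extendZero d) (laplaceOp (N + 1) n P) =
      coeffAt d (laplaceOp N n (restrictLast N P)) + (n : QAlpha) * coeffAt (extendZero d) P := by
  have hP' : HasDegree n (restrictLast N P) := fun d hd => by
    rw [coeffAt_restrictLast] at hd
    rw [← hP _ hd, sum_extendZero]
  have hn : ((∑ i, d i : ℕ) : QAlpha) * coeffAt (extendZero d) P =
      (n : QAlpha) * coeffAt (extendZero d) P := by
    by_cases h : coeffAt (extendZero d) P = 0
    · rw [h, mul_zero, mul_zero]
    · rw [← hP _ h, sum_extendZero]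
  rw [coeffAt_laplaceOp_eq_pairCoeff hP, coeffAt_laplaceOp_eq_pairCoeff hP',
    coeffAt_restrictLast, ← hn]
  have h1 : ∀ i j : Fin N, pairCoeff (fun d => coeffAt d P) i.castSucc j.castSucc (extendZero d) =
      pairCoeff (fun d => coeffAt d (restrictLast N P)) i j d := by
    intro i j
    simp only [pairCoeff, extendZero_castSucc, extendZero_spread, coeffAt_restrictLast]
  have h2 : ∀ i : Fin N, pairCoeff (fun d => coeffAt d P) i.castSucc (Fin.last N) (extendZero d) =
      (d i : QAlpha) * coeffAt (extendZero d) P := by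
    intro i
    simp [pairCoeff, extendZero_castSucc, extendZero_last]
  have h3 : ∀ i : Fin N, pairCoeff (fun d => coeffAt d P) (Fin.last N) i.castSucc (extendZero d) =
      (d i : QAlpha) * coeffAt (extendZero d) P := by
    intro i
    simp [pairCoeff, extendZero_castSucc, extendZero_last]
  have h4 : ∑ i : Fin (N + 1), ∑ j ∈ Finset.univ.filter (fun j => j ≠ i),
        pairCoeff (fun d => coeffAt d P) i j (extendZero d) =
      ∑ i : Fin N, ∑ j ∈ Finset.univ.filter (fun j => j ≠ i),
        pairCoeff (fun d => coeffAt d (restrictLast N P)) i j d +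
        2 * (((∑ i, d i : ℕ) : QAlpha) * coeffAt (extendZero d) P) := by
    simp only [Finset.sum_filter, Fin.sum_univ_castSucc, h1, h2, h3, ne_eq,
      (Fin.castSucc_injective N).eq_iff, Fin.castSucc_ne_last, (Fin.castSucc_ne_last _).symm,
      not_true_eq_false, not_false_eq_true, if_true, if_false, Finset.sum_add_distrib, add_zero]
    rw [Nat.cast_sum, Finset.sum_mul]
    ring
  have h5 : ∑ i, (extendZero d i).choose 2 = ∑ i, (d i).choose 2 := by
    rw [Fin.sum_univ_castSucc, extendZero_last]
    simp [extendZero_castSucc]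
  rw [h4, h5]
  ring

theorem isJack_restrictLast {lam : YoungDiagram} (hN : lam.colLen 0 ≤ N)
    {P : MvPolynomial (Fin (N + 1)) QAlpha} (h : IsJack (N + 1) lam P) :
    IsJack N lam (restrictLast N P) := by
  obtain ⟨hs, hd, htop, he⟩ := (isJack_iff (hN.trans (Nat.le_succ N))).mp h
  have hcoeff : ∀ d, coeffAt d (restrictLast N P) = coeffAt (rowVec (N + 1) (shape d)) P := by
    intro d
    rw [coeffAt_restrictLast, coeffAt_eq_coeffAt_shape hs, shape_extendZero]
  refine (isJack_iff hN).mpr ⟨isSymmetric_iff.mpr fun e d => ?_, fun d hne => ?_, ?_, ?_⟩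
  · rw [hcoeff, hcoeff]
    congr 3
    refine rowLens_injective ?_
    rw [← nonzeroEntries_eq_rowLens_shape, ← nonzeroEntries_eq_rowLens_shape,
      nonzeroEntries_comp_perm]
  · rw [coeffAt_restrictLast] at hne
    exact (hd _ hne).of_extendZero
  · rw [hcoeff, shape_rowVec hN, htop]
  · refine ext_coeffAt fun d => ?_
    have h1 := coeffAt_extendZero_laplaceOp hd.hasDegree d
    rw [he, coeffAt_C_mul, eigenvalue_succ] at h1
    rw [coeffAt_C_mul, coeffAt_restrictLast]
    linear_combination -h1

theorem restrictLast_jack (N : ℕ) (lam : YoungDiagram) :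
    restrictLast N (jack (N + 1) lam) = jack N lam := by
  rcases le_or_gt (lam.colLen 0) N with hN | hN
  · exact (jack_eq_of_isJack hN
      (isJack_restrictLast hN (jack_isJack (hN.trans (Nat.le_succ N))))).symm
  · rw [jack_eq_zero hN]
    rcases le_or_gt (lam.colLen 0) (N + 1) with hN1 | hN1
    -- Here λ has exactly N + 1 parts. A monomial in the first N variables would have degree at most
    -- λ_1 + ⋯ + λ_N < |λ|.
    · obtain ⟨_, hd, _, _⟩ := (isJack_iff hN1).mp (jack_isJack hN1)
      refine ext_coeffAt fun d => ?_
      rw [coeffAt_restrictLast, map_zero]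
      by_contra h
      have hdom := hd _ h
      have h1 := hdom.of_extendZero.2 Finset.univ
      rw [hdom.of_extendZero.1, Finset.card_univ, Fintype.card_fin] at h1
      have h2 := sum_range_rowLen hN1
      rw [Finset.sum_range_succ] at h2
      have h3 : lam.rowLen N ≠ 0 := fun h0 => absurd (rowLen_eq_zero_iff.mp h0) (not_le.mpr hN)
      omega
    · rw [jack_eq_zero hN1, map_zero]

end Restriction

/-! ### Behaviour under entry-wise sums of partitions. -/

section Additivity

variable {N : ℕ} {lam mu nu : YoungDiagram}

theorem card_of_rowLen_add (hl : lam.colLen 0 ≤ N) (hm : mu.colLen 0 ≤ N) (hn : nu.colLen 0 ≤ N)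
    (h : ∀ k, nu.rowLen k = lam.rowLen k + mu.rowLen k) : nu.card = lam.card + mu.card := by
  rw [← sum_range_rowLen hl, ← sum_range_rowLen hm, ← sum_range_rowLen hn,
    ← Finset.sum_add_distrib]
  exact Finset.sum_congr rfl fun k _ => h k

theorem add_choose_two (a b : ℕ) : (a + b).choose 2 = a.choose 2 + b.choose 2 + a * b := by
  have h : (((a + b).choose 2 : ℕ) : ℚ) = ((a.choose 2 + b.choose 2 + a * b : ℕ) : ℚ) := by
    push_cast
    rw [Nat.cast_choose_two, Nat.cast_choose_two, Nat.cast_choose_two]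
    push_cast
    ring
  exact_mod_cast h

/-- The size and b(λᵗ) are linear in the parts; only b(λ) is quadratic, with polarization ∑ λ_k μ_k.
Since the defect is bilinear and carries a factor α, it can be absorbed into Γ. -/
theorem eigenvalue_of_rowLen_add (hl : lam.colLen 0 ≤ N) (hm : mu.colLen 0 ≤ N)
    (hn : nu.colLen 0 ≤ N) (h : ∀ k, nu.rowLen k = lam.rowLen k + mu.rowLen k) :
    eigenvalue N nu = eigenvalue N lam + eigenvalue N mu +
      alpha * ((∑ k ∈ Finset.range N, lam.rowLen k * mu.rowLen k : ℕ) : QAlpha) := by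
  have h1 : bStat nu = bStat lam + bStat mu +
      ∑ k ∈ Finset.range N, lam.rowLen k * mu.rowLen k := by
    rw [bStat_eq hl, bStat_eq hm, bStat_eq hn,
      ← Fin.sum_univ_eq_sum_range (fun k => lam.rowLen k * mu.rowLen k), ← Finset.sum_add_distrib,
      ← Finset.sum_add_distrib]
    refine Finset.sum_congr rfl fun i _ => ?_
    rw [rowVec, h, add_choose_two]
    rfl
  have h2 : bStat nu.transpose = bStat lam.transpose + bStat mu.transpose := by
    rw [bStat_transpose hl, bStat_transpose hm, bStat_transpose hn, ← Finset.sum_add_distrib]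
    exact Finset.sum_congr rfl fun k _ => by rw [h, mul_add]
  rw [eigenvalue, h1, h2, card_of_rowLen_add hl hm hn h]
  simp only [eigenvalue]
  push_cast
  ring

theorem SupportDominated.mul (hl : lam.colLen 0 ≤ N) (hm : mu.colLen 0 ≤ N)
    (hn : nu.colLen 0 ≤ N) (h : ∀ k, nu.rowLen k = lam.rowLen k + mu.rowLen k)
    {P Q : MvPolynomial (Fin N) QAlpha} (hP : SupportDominated lam P)
    (hQ : SupportDominated mu Q) : SupportDominated nu (P * Q) := by
  intro d hd
  obtain ⟨a, b, rfl, ha, hb⟩ := coeffAt_mul_ne_zero hd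
  have ha := hP a ha
  have hb := hQ b hb
  refine ⟨?_, fun S => ?_⟩
  · rw [card_of_rowLen_add hl hm hn h, ← ha.1, ← hb.1, ← Finset.sum_add_distrib]
    rfl
  · simp only [Pi.add_apply, h, Finset.sum_add_distrib]
    exact add_le_add (ha.2 S) (hb.2 S)

/-- If a + b = λ + μ with a dominated by λ and b by μ, then all partial sums are extremal, whence a
= λ and b = μ. -/
theorem coeffAt_rowVec_mul (h : ∀ k, nu.rowLen k = lam.rowLen k + mu.rowLen k)
    {P Q : MvPolynomial (Fin N) QAlpha} (hP : SupportDominated lam P)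
    (hQ : SupportDominated mu Q) : coeffAt (rowVec N nu) (P * Q) =
      coeffAt (rowVec N lam) P * coeffAt (rowVec N mu) Q := by
  have h1 : rowVec N nu = rowVec N lam + rowVec N mu := funext fun i => h i
  rw [h1]
  refine coeffAt_mul_of_unique fun a b hab ha hb => sum_Iic_eq_of_forall fun j => ?_
  have h2 := (hP a ha).sum_Iic_le j
  have h3 := (hQ b hb).sum_Iic_le j
  have h4 : ∑ i ∈ Finset.Iic j, (a + b) i =
      ∑ i ∈ Finset.Iic j, (rowVec N lam + rowVec N mu) i := by rw [hab]
  simp only [Pi.add_apply, Finset.sum_add_distrib] at h4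
  omega

theorem SupportDominated.sub {P Q : MvPolynomial (Fin N) QAlpha} (hP : SupportDominated lam P)
    (hQ : SupportDominated lam Q) : SupportDominated lam (P - Q) := fun d hd => by
  by_cases h : coeffAt d P = 0
  · exact hQ d fun h' => hd (by rw [map_sub, h, h', sub_zero])
  · exact hP d h

theorem SupportDominated.sum {κ : Type*} (s : Finset κ) (f : κ → MvPolynomial (Fin N) QAlpha)
    (h : ∀ i ∈ s, SupportDominated lam (f i)) : SupportDominated lam (∑ i ∈ s, f i) := by
  intro d hd
  rw [map_sum] at hd
  obtain ⟨i, hi, hne⟩ := Finset.exists_ne_zero_of_sum_ne_zero hd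
  exact h i hi d hne

end Additivity

/-! ### Order estimates for polynomials and the product rule of the shifted operator. -/

section PolynomialOrder

variable {N : ℕ}

/-- All coefficients of `P` are `O(α^k)`. -/
def CoeffsOAlpha (k : ℤ) (P : MvPolynomial (Fin N) QAlpha) : Prop :=
  ∀ d : Fin N → ℕ, IsOAlpha k (coeffAt d P)

theorem CoeffsOAlpha.mul {k l : ℤ} {P Q : MvPolynomial (Fin N) QAlpha} (hP : CoeffsOAlpha k P)
    (hQ : CoeffsOAlpha l Q) : CoeffsOAlpha (k + l) (P * Q) := by
  intro d
  rw [coeffAt_apply, MvPolynomial.coeff_mul]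
  refine isOAlpha_sum _ _ fun x _ => ?_
  rw [coeff_eq_coeffAt, coeff_eq_coeffAt]
  exact (hP _).mul (hQ _)

theorem CoeffsOAlpha.X_mul_pderiv {k : ℤ} {P : MvPolynomial (Fin N) QAlpha}
    (hP : CoeffsOAlpha k P) (i : Fin N) :
    CoeffsOAlpha k (MvPolynomial.X i * MvPolynomial.pderiv i P) := by
  intro d
  rw [coeffAt_X_mul_pderiv]
  exact (isOAlpha_natCast _).mul_left (hP d)

/-- The functions that are `O(α^k)`, as a rational vector space. -/
def oAlphaSubmodule (k : ℤ) : Submodule ℚ QAlpha where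
  carrier := {f | IsOAlpha k f}
  zero_mem' := isOAlpha_zero k
  add_mem' := IsOAlpha.add
  smul_mem' := fun c f hf => by
    rw [Algebra.smul_def]
    exact (isOAlpha_algebraMap c).mul_left hf

/-- The symbol `∑ x_i² ∂_i f ∂_i g`, corrected by a multiple of `f g`. -/
def gammaForm (N : ℕ) (c : QAlpha) : MvPolynomial (Fin N) QAlpha →+
    MvPolynomial (Fin N) QAlpha →+ MvPolynomial (Fin N) QAlpha :=
  AddMonoidHom.mk' (fun f => AddMonoidHom.mk' (fun g =>
    ∑ i, MvPolynomial.X i ^ 2 * MvPolynomial.pderiv i f * MvPolynomial.pderiv i g -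
      MvPolynomial.C c * f * g) (fun g g' => by
        simp only [map_add, mul_add, Finset.sum_add_distrib]
        ring)) (fun f f' => by
      refine AddMonoidHom.ext fun g => ?_
      simp only [AddMonoidHom.mk'_apply, AddMonoidHom.add_apply, map_add, mul_add, add_mul,
        Finset.sum_add_distrib]
      ring)

theorem gammaForm_apply (c : QAlpha) (f g : MvPolynomial (Fin N) QAlpha) :
    gammaForm N c f g =
      ∑ i, MvPolynomial.X i ^ 2 * MvPolynomial.pderiv i f * MvPolynomial.pderiv i g -
      MvPolynomial.C c * f * g := rfl

theorem CoeffsOAlpha.gammaForm {k l : ℤ} {f g : MvPolynomial (Fin N) QAlpha} (c : ℕ)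
    (hf : CoeffsOAlpha k f) (hg : CoeffsOAlpha l g) :
    CoeffsOAlpha (k + l) (gammaForm N c f g) := by
  intro d
  rw [gammaForm_apply, map_sub, map_sum, mul_assoc, coeffAt_C_mul]
  refine IsOAlpha.sub (isOAlpha_sum _ _ fun i _ => ?_)
    ((isOAlpha_natCast _).mul_left (hf.mul hg d))
  have : MvPolynomial.X i ^ 2 * MvPolynomial.pderiv i f * MvPolynomial.pderiv i g =
      (MvPolynomial.X i * MvPolynomial.pderiv i f) *
        (MvPolynomial.X i * MvPolynomial.pderiv i g) := by ring
  rw [this]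
  exact (hf.X_mul_pderiv i).mul (hg.X_mul_pderiv i) d

/-- The symbol is a derivation in its second argument, and the correction constants add up; this is
the hypothesis on Γ in `secondOrder_cumulant`. -/
theorem gammaForm_mul (a b : QAlpha) (f g k : MvPolynomial (Fin N) QAlpha) :
    gammaForm N (a + b) f (g * k) = gammaForm N a f g * k + g * gammaForm N b f k := by
  simp only [gammaForm_apply, MvPolynomial.pderiv_mul, mul_add, Finset.sum_add_distrib, map_add,
    sub_mul, mul_sub, Finset.sum_mul, Finset.mul_sum]
  have h1 : ∀ i : Fin N, MvPolynomial.X i ^ 2 * MvPolynomial.pderiv i f *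
      (g * MvPolynomial.pderiv i k) =
      g * (MvPolynomial.X i ^ 2 * MvPolynomial.pderiv i f * MvPolynomial.pderiv i k) :=
    fun i => by ring
  have h2 : ∀ i : Fin N, MvPolynomial.X i ^ 2 * MvPolynomial.pderiv i f *
      (MvPolynomial.pderiv i g * k) =
      MvPolynomial.X i ^ 2 * MvPolynomial.pderiv i f * MvPolynomial.pderiv i g * k :=
    fun i => by ring
  simp only [h1, h2]
  ring

theorem D1_mul (f g : MvPolynomial (Fin N) QAlpha) :
    D1 N (f * g) = D1 N f * toRat N g + toRat N f * D1 N g := by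
  simp only [D1, Finset.sum_mul, Finset.mul_sum, ← Finset.sum_add_distrib]
  refine Finset.sum_congr rfl fun i _ => Finset.sum_congr rfl fun j _ => ?_
  rw [MvPolynomial.pderiv_mul, map_add, map_mul, map_mul]
  ring

theorem D2_mul (f g : MvPolynomial (Fin N) QAlpha) :
    D2 N (f * g) = D2 N f * g + f * D2 N g +
      ∑ i, MvPolynomial.X i ^ 2 * MvPolynomial.pderiv i f * MvPolynomial.pderiv i g := by
  have hC : (MvPolynomial.C (1 / 2 : QAlpha) : MvPolynomial (Fin N) QAlpha) * 2 = 1 := by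
    rw [← map_ofNat MvPolynomial.C 2, ← MvPolynomial.C_mul]
    norm_num
  have h : ∀ i : Fin N, MvPolynomial.X i ^ 2 *
      MvPolynomial.pderiv i (MvPolynomial.pderiv i (f * g)) =
      (MvPolynomial.X i ^ 2 * MvPolynomial.pderiv i (MvPolynomial.pderiv i f)) * g +
      f * (MvPolynomial.X i ^ 2 * MvPolynomial.pderiv i (MvPolynomial.pderiv i g)) +
      2 * (MvPolynomial.X i ^ 2 * MvPolynomial.pderiv i f * MvPolynomial.pderiv i g) := by
    intro i
    simp only [MvPolynomial.pderiv_mul, map_add]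
    ring
  simp only [D2, h, Finset.sum_add_distrib, ← Finset.sum_mul, ← Finset.mul_sum]
  linear_combination (∑ i, MvPolynomial.X i ^ 2 * MvPolynomial.pderiv i f *
    MvPolynomial.pderiv i g) * hC

/-- The shifted Laplace-Beltrami operator with values in rational functions. -/
def shiftedLaplaceBeltrami (N : ℕ) (c : QAlpha) : MvPolynomial (Fin N) QAlpha →+ RatField N :=
  AddMonoidHom.mk' (fun f => laplaceBeltrami N f - toRat N (MvPolynomial.C c * f)) (fun f g => by
    simp only [laplaceBeltrami, D1, D2, map_add, mul_add, Finset.sum_add_distrib]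
    ring)

theorem shiftedLaplaceBeltrami_apply (c : QAlpha) (f : MvPolynomial (Fin N) QAlpha) :
    shiftedLaplaceBeltrami N c f = laplaceBeltrami N f - toRat N (MvPolynomial.C c * f) := rfl

/-- D_1 is a derivation, the cross term of D_2 is the symbol, and the part α c of the shift is the
correction inside `gammaForm`. -/
theorem shiftedLaplaceBeltrami_mul (a b c : QAlpha) (f g : MvPolynomial (Fin N) QAlpha) :
    shiftedLaplaceBeltrami N (a + b + alpha * c) (f * g) =
      shiftedLaplaceBeltrami N a f * toRat N g + toRat N f * shiftedLaplaceBeltrami N b g +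
        toRat N (MvPolynomial.C alpha * gammaForm N c f g) := by
  simp only [shiftedLaplaceBeltrami_apply, laplaceBeltrami, D1_mul, D2_mul, gammaForm_apply,
    map_add, map_sub, map_mul, mul_add, mul_sub]
  ring

end PolynomialOrder

/-! ### The estimate of the cumulants of Jack polynomials. -/

section Main

variable {N r : ℕ} {lam : Fin r → YoungDiagram}

theorem rowLen_entrywiseSum_union {A B : Finset (Fin r)} (h : Disjoint A B) (k : ℕ) :
    (entrywiseSum lam (A ∪ B)).rowLen k =
      (entrywiseSum lam A).rowLen k + (entrywiseSum lam B).rowLen k := by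
  simp only [rowLen_entrywiseSum, Finset.sum_union h]

theorem jack_bot : jack N ⊥ = 1 := by
  have hN : (⊥ : YoungDiagram).colLen 0 ≤ N := by
    rw [← rowLen_eq_zero_iff]
    by_contra h
    exact YoungDiagram.notMem_bot (N, 0)
      (YoungDiagram.mem_iff_lt_rowLen.mpr (Nat.pos_of_ne_zero h))
  obtain ⟨_, hd, htop, _⟩ := (isJack_iff hN).mp (jack_isJack (N := N) hN)
  have h0 : ∀ d : Fin N → ℕ, DominatedBy ⊥ d → d = 0 := by
    intro d h
    have := h.1
    rw [show (⊥ : YoungDiagram).card = 0 from rfl, Finset.sum_eq_zero_iff] at this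
    exact funext fun i => this i (Finset.mem_univ i)
  have h1 : rowVec N ⊥ = 0 := h0 _ (dominatedBy_self hN)
  refine ext_coeffAt fun d => ?_
  have h2 : coeffAt d (1 : MvPolynomial (Fin N) QAlpha) = if 0 = d then 1 else 0 := by
    rw [← MvPolynomial.C_1, MvPolynomial.C_apply, coeffAt_monomial]
    rfl
  rw [h2]
  split_ifs with h
  · rw [← h, ← h1, htop, hook_bot]
  · by_contra hne
    exact h (h0 d (hd d hne)).symm

theorem jack_entrywiseSum_empty : jack N (entrywiseSum lam ∅) = 1 := by
  rw [entrywiseSum_empty, jack_bot]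

theorem cumulant_eq_sub {ι R : Type*} [DecidableEq ι] [CommRing R] {u : Finset ι → R}
    (hu : u ∅ = 1) {H : Finset ι} {h : ι} (hh : h ∈ H) : cumulant u H =
      u H - ∑ A ∈ H.ssubsets.filter (h ∈ ·), cumulant u A * u (H \ A) := by
  have := conv_pointed_cumulant hu hh
  rw [conv_eq_add_sum_ssubsets, hu, mul_one, pointed, if_pos hh] at this
  rw [← this, Finset.sum_filter]
  simp [pointed, ite_mul]

/-- The leading term of the cumulants of Jack polynomials. -/
theorem cumulant_jack_leading (hN : ∀ i, (lam i).colLen 0 ≤ N) {H : Finset (Fin r)}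
    (hH : H.Nonempty) :
    (cumulant (fun B => jack N (entrywiseSum lam B)) H).IsSymmetric ∧
    SupportDominated (entrywiseSum lam H) (cumulant (fun B => jack N (entrywiseSum lam B)) H) ∧
    coeffAt (rowVec N (entrywiseSum lam H)) (cumulant (fun B => jack N (entrywiseSum lam B)) H) =
      cumulant (fun B => hook (entrywiseSum lam B)) H := by
  have hcol : ∀ B, (entrywiseSum lam B).colLen 0 ≤ N := fun B =>
    colLen_entrywiseSum_le fun i _ => hN i
  induction H using Finset.strongInduction with
  | H H ih =>
    obtain ⟨h, hh⟩ := hH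
    have hJ := fun B => (isJack_iff (hcol B)).mp (jack_isJack (hcol B))
    -- Taking the leading coefficient is multiplicative, so it turns the recursion for Jack
    -- polynomials into the one for hooks.
    rw [cumulant_eq_sub (u := fun B => jack N (entrywiseSum lam B)) jack_entrywiseSum_empty hh,
      cumulant_eq_sub (u := fun B => hook (entrywiseSum lam B))
        (by rw [entrywiseSum_empty, hook_bot]) hh]
    have hA : ∀ A ∈ H.ssubsets.filter (h ∈ ·), A ⊂ H ∧ A.Nonempty := fun A hA =>
      ⟨Finset.mem_ssubsets.mp (Finset.mem_filter.mp hA).1, ⟨h, (Finset.mem_filter.mp hA).2⟩⟩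
    have hrow : ∀ A ∈ H.ssubsets.filter (h ∈ ·), ∀ k, (entrywiseSum lam H).rowLen k =
        (entrywiseSum lam A).rowLen k + (entrywiseSum lam (H \ A)).rowLen k := by
      intro A hA' k
      rw [← rowLen_entrywiseSum_union Finset.disjoint_sdiff,
        Finset.union_sdiff_of_subset (hA A hA').1.subset]
    refine ⟨(hJ H).1.sub ?_, (hJ H).2.1.sub (SupportDominated.sum _ _ fun A hA' => ?_), ?_⟩
    · refine Subalgebra.sum_mem (MvPolynomial.symmetricSubalgebra (Fin N) QAlpha)
        fun A hA' => ?_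
      exact (ih A (hA A hA').1 (hA A hA').2).1.mul (hJ (H \ A)).1
    · exact (ih A (hA A hA').1 (hA A hA').2).2.1.mul (hcol _) (hcol _) (hcol _) (hrow A hA')
        (hJ (H \ A)).2.1
    · rw [map_sub, map_sum, (hJ H).2.2.1]
      congr 1
      refine Finset.sum_congr rfl fun A hA' => ?_
      have h1 := ih A (hA A hA').1 (hA A hA').2
      rw [coeffAt_rowVec_mul (hrow A hA') h1.2.1 (hJ (H \ A)).2.1, h1.2.2, (hJ (H \ A)).2.2.1]

/-- The strong factorization property of Jack polynomials. -/
theorem coeffsOAlpha_cumulant_jack (hN : ∀ i, (lam i).colLen 0 ≤ N) {H : Finset (Fin r)}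
    (hH : H.Nonempty) : CoeffsOAlpha ((H.card : ℤ) - 1)
      (cumulant (fun B => jack N (entrywiseSum lam B)) H) := by
  have hcol : ∀ B, (entrywiseSum lam B).colLen 0 ≤ N := fun B =>
    colLen_entrywiseSum_le fun i _ => hN i
  set u : Finset (Fin r) → MvPolynomial (Fin N) QAlpha := fun B => jack N (entrywiseSum lam B)
    with hudef
  have hu : u ∅ = 1 := jack_entrywiseSum_empty
  induction H using Finset.strongInduction with
  | H H ih =>
    obtain ⟨h, hh⟩ := hH
    obtain ⟨hs, hd, htop⟩ := cumulant_jack_leading hN ⟨h, hh⟩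
    let c : Finset (Fin r) → Finset (Fin r) → ℕ := fun A B =>
      ∑ k ∈ Finset.range N, (entrywiseSum lam A).rowLen k * (entrywiseSum lam B).rowLen k
    -- The identity is obtained in the field of rational functions, because D_1 need not preserve
    -- polynomials that are not symmetric.
    have hode := secondOrder_cumulant (toRat N)
      (fun A => shiftedLaplaceBeltrami N (eigenvalue N (entrywiseSum lam A)))
      (fun A B => gammaForm N (c A B)) (MvPolynomial.C alpha)
      (fun A B hAB f g => by
        rw [eigenvalue_of_rowLen_add (hcol A) (hcol B) (hcol _) (rowLen_entrywiseSum_union hAB)]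
        exact shiftedLaplaceBeltrami_mul _ _ _ f g)
      (fun A B C hBC f g k => by
        rw [← gammaForm_mul, ← Nat.cast_add]
        congr 4
        simp only [c, rowLen_entrywiseSum_union hBC, mul_add, Finset.sum_add_distrib])
      hu (fun A => by
        rw [shiftedLaplaceBeltrami_apply, sub_eq_zero]
        exact (jack_isJack (hcol A)).eigen) hh
    -- The cumulant is symmetric and homogeneous, so the identity descends to polynomials.
    rw [shiftedLaplaceBeltrami_apply, laplaceBeltrami_eq_toRat hs hd.hasDegree, ← map_sub,
      ← map_neg] at hode
    have hpoly := IsFractionRing.injective (MvPolynomial (Fin N) QAlpha) (RatField N) hode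
    refine coeffAt_mem_of_triangular (oAlphaSubmodule ((H.card : ℤ) - 1))
      (fun a b ha x hx => (isOAlpha_inv_linear b ha).mul_left hx) (hcol H) hs hd ?_ fun d => ?_
    · rw [htop]
      exact isOAlpha_cumulant_hook hN ⟨h, hh⟩
    · rw [← coeffAt_C_mul, ← map_sub, hpoly, map_neg, coeffAt_C_mul, map_sum, Finset.mul_sum]
      refine IsOAlpha.neg (isOAlpha_sum _ _ fun A hA => ?_)
      rw [Finset.mem_powerset] at hA
      unfold pointed reducedCumulant
      split_ifs with hhA hempty
      · simp only [map_zero, mul_zero]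
        exact isOAlpha_zero _
      -- Both A and H \ A are nonempty and proper, and the orders add up to 1 + (|A| - 1) + (|H \ A|
      -- - 1) = |H| - 1.
      · have hne : A ≠ H := fun e => hempty (by rw [e, Finset.sdiff_self])
        have h1 := ih A (Finset.ssubset_iff_subset_ne.mpr ⟨hA, hne⟩) ⟨h, hhA⟩
        have h2 := ih (H \ A) (Finset.sdiff_ssubset hA ⟨h, hhA⟩)
          (Finset.nonempty_iff_ne_empty.mpr hempty)
        refine (isOAlpha_alpha.mul (h1.gammaForm (c A (H \ A)) h2 d)).mono ?_
        have := Finset.card_sdiff_add_card_eq_card hA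
        omega
      · simp only [map_zero, mul_zero]
        exact isOAlpha_zero _
      · simp only [map_zero, AddMonoidHom.zero_apply, mul_zero]
        exact isOAlpha_zero _

/-- In every set partition, the block containing i indexes a partition with more than N parts, so
each product vanishes. -/
theorem jackCumulant_eq_zero {i : Fin r} (hi : N < (lam i).colLen 0) :
    jackCumulant N lam = 0 := by
  unfold jackCumulant cumulant
  refine Finset.sum_eq_zero fun p _ => ?_
  obtain ⟨B, hB, hiB⟩ := p.exists_mem (Finset.mem_univ i)
  rw [Finset.prod_eq_zero hB, mul_zero]
  refine jack_eq_zero ?_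
  rw [← not_le, ← rowLen_eq_zero_iff, rowLen_entrywiseSum] at *
  exact fun h => hi (Finset.sum_eq_zero_iff.mp h i hiB)

theorem isOAlpha_coeff_jackCumulant (hr : 1 ≤ r) (lam : Fin r → YoungDiagram) (N : ℕ)
    (d : Fin N →₀ ℕ) :
    IsOAlpha ((r : ℤ) - 1) (MvPolynomial.coeff d (jackCumulant N lam)) := by
  by_cases hN : ∀ i, (lam i).colLen 0 ≤ N
  · have hne : (Finset.univ : Finset (Fin r)).Nonempty := ⟨⟨0, hr⟩, Finset.mem_univ _⟩
    have := coeffsOAlpha_cumulant_jack hN hne d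
    rwa [Finset.card_univ, Fintype.card_fin, ← coeff_eq_coeffAt] at this
  · push Not at hN
    obtain ⟨i, hi⟩ := hN
    rw [jackCumulant_eq_zero hi, MvPolynomial.coeff_zero]
    exact isOAlpha_zero _

end Main

end JackCumulant

end

/-- The first two items say that the Jack polynomials exist, are unique, and are compatible when the
number of variables varies (so that they define symmetric functions); the third is the estimate of
their cumulants, coefficient by coefficient and in any number of variables. -/
theorem mainTheorem2 :
    (∀ (N : ℕ) (lam : YoungDiagram), lam.colLen 0 ≤ N →
      ∃! P : MvPolynomial (Fin N) JackCumulant.QAlpha, JackCumulant.IsJack N lam P) ∧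
    (∀ (N : ℕ) (lam : YoungDiagram),
      JackCumulant.restrictLast N (JackCumulant.jack (N + 1) lam) = JackCumulant.jack N lam) ∧
    (∀ (r : ℕ), 1 ≤ r → ∀ (lam : Fin r → YoungDiagram) (N : ℕ) (d : Fin N →₀ ℕ),
      JackCumulant.IsOAlpha ((r : ℤ) - 1)
        (MvPolynomial.coeff d (JackCumulant.jackCumulant N lam))) :=
  ⟨fun _ _ hN => JackCumulant.existsUnique_isJack hN, JackCumulant.restrictLast_jack,
    fun _ hr lam N d => JackCumulant.isOAlpha_coeff_jackCumulant hr lam N d⟩
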